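/- Setting. Let $P_0,P_1,P_2,\dots$ be non-symmetric operads, where $P_n$ is an operad (for the cartesian product) in the category $\mathcal V_n$, with $\mathcal V_0=\mathbf{Set}$ and $\mathcal V_{n+1}=(\mathcal V_n,P_n)\text{-}\mathbf{Cat}$. Here a $(\mathcal V,P)$-category is a $\mathcal V$-graph $A$ with composition morphisms $P(k)\times A(a_{k-1},a_k)\times\dots\times A(a_0,a_1)\to A(a_0,a_k)$ for all $k\ge 0$ and all objects $a_0,\dots,a_k$, compatible with the unit and composition of $P$. Write $0\text{-}\mathbf{Gph}=\mathbf{Set}$ and $n\text{-}\mathbf{Gph}=((n-1)\text{-}\mathbf{Gph})\text{-}\mathbf{Gph}$ (equivalently, $n$-globular sets), and let $U:\mathcal V_n\to n\text{-}\mathbf{Gph}$ be the forgetful functor; the $j$-cells of an object $A$ of $\mathcal V_n$ are the $j$-cells of $UA$. For $\mathcal V=n\text{-}\mathbf{Gph}$ and objects $R(k)$ of $\mathcal V$ ($k\ge0$) let $\mathrm{fc}_{(\mathcal V,R)}$ be the functor on $\mathcal V$-graphs that is the identity on objects and is given on hom-objects by $$(\mathrm{fc}_{(\mathcal V,R)}A)(a,a')=\coprod_{k\ge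 0,\ a=a_0,\dots,a_k=a'}R(k)\times A(a_{k-1},a_k)\times\dots\times A(a_0,a_1),$$ and put $\mathrm{fc}_{\mathcal V}=\mathrm{fc}_{(\mathcal V,1)}$. For a functor $F$ let $F_*$ be the functor between categories of enriched graphs that is the identity on objects and $F$ on hom-objects. Define functors $Q^{(n)}$ and $T^{(n)}$ on $n\text{-}\mathbf{Gph}$ by $Q^{(0)}=T^{(0)}=\mathrm{id}$, $Q^{(n+1)}=\mathrm{fc}_{(\mathcal V,UP_n)}\circ (Q^{(n)})_*$ and $T^{(n+1)}=\mathrm{fc}_{\mathcal V}\circ (T^{(n)})_*$ with $\mathcal V=n\text{-}\mathbf{Gph}$; these are the functors underlying the monads for $n$-categories of the theory and for strict $n$-categories. Let $p:Q^{(n)}\Rightarrow T^{(n)}$ be the natural transformation that forgets the factors $P_i(k)$, and let $1$ be the terminal $n$-graph. An $m$-stage tree is, for $m=0$, a point, and for $m\ge1$ a finite (possibly empty) sequence of $(m-1)$-stage trees, joined by a new base node; its nodes at heights $b<m$ have an arity $k\ge0$, while the tips at height $m$ have none. Proposition. Let $n>0$. (a) For $m\le n$ the $m$-cells of $T^{(n)}(1)$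 are, by the canonical recursive identification, the $m$-stage trees $\alpha$; both the source and the target of $\alpha$ are found by forgetting the top level of $\alpha$. (b) For $m\le n$, an $m$-cell of $Q^{(n)}(1)$ lying over (that is, mapped by $p$ to) an $m$-stage tree $\alpha$ consists of a label for each node of $\alpha$ of height less than $m$, where a node of arity $k\ge 0$ at height $b$ ($0\le b<m\le n$) is labelled by an $(m-b-1)$-cell of $P_{n-b-1}(k)$. Precisely, assigning to a cell its labels is a bijection from the $m$-cells over $\alpha$ onto all such labellings of $\alpha$; here the label of the base node is the component in $P_{n-1}(k)$, and the labels of the remaining nodes are, recursively, those of the $k$ components in $Q^{(n-1)}(1)$. (c) The source (respectively target) of such an element is found by forgetting the top level of the tree and the top level of labels, and replacing each remaining label by its source (respectively target). -/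

import Mathlib

open CategoryTheory CategoryTheory.Limits

universe u

namespace Iterative

/-! ## Graphs enriched in a category -/

/-- A `V`-graph: a set of objects and, for every pair of objects, a hom-object in `V`. -/
structure VGraph (V : Type (u + 1)) [Category.{u} V] : Type (u + 1) where
  obj : Type u
  hom : obj → obj → V

namespace VGraph

variable {V : Type (u + 1)} [Category.{u} V]

/-- A morphism of `V`-graphs. -/
@[ext]
structure Hom (A B : VGraph V) : Type u where
  obj : A.obj → B.obj
  map : ∀ x y : A.obj, A.hom x y ⟶ B.hom (obj x) (obj y)

instance : Category.{u} (VGraph V) where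
  Hom A B := Hom A B
  id A := ⟨fun x => x, fun _ _ => 𝟙 _⟩
  comp f g := ⟨fun x => g.obj (f.obj x), fun x y => f.map x y ≫ g.map _ _⟩
  id_comp f := Hom.ext rfl (heq_of_eq (by funext x y; exact Category.id_comp _))
  comp_id f := Hom.ext rfl (heq_of_eq (by funext x y; exact Category.comp_id _))
  assoc f g h := Hom.ext rfl (heq_of_eq (by funext x y; exact Category.assoc _ _ _))

/-- Two morphisms of `V`-graphs agree if they have the same function on objects and the same
components on hom-objects. -/
theorem hom_eq {A B : VGraph V} {o : A.obj → B.obj}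
    {m m' : ∀ x y : A.obj, A.hom x y ⟶ B.hom (o x) (o y)} (h : ∀ x y, m x y = m' x y) :
    (Hom.mk o m : A ⟶ B) = Hom.mk o m' :=
  Hom.ext rfl (heq_of_eq (by funext x y; exact h x y))

/-- The suspension `F_*` of a functor `F`: the identity on objects, `F` on hom-objects. -/
def star {W : Type (u + 1)} [Category.{u} W] (F : V ⥤ W) : VGraph V ⥤ VGraph W where
  obj A := ⟨A.obj, fun x y => F.obj (A.hom x y)⟩
  map f := ⟨f.obj, fun x y => F.map (f.map x y)⟩
  map_id _ := hom_eq fun _ _ => F.map_id _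
  map_comp _ _ := hom_eq fun _ _ => F.map_comp _ _

/-- The suspension of a natural transformation. -/
def starMap {W : Type (u + 1)} [Category.{u} W] {F G : V ⥤ W} (η : F ⟶ G) :
    star F ⟶ star G where
  app A := ⟨fun x => x, fun x y => η.app (A.hom x y)⟩
  naturality _ _ f := hom_eq fun x y => η.naturality (f.map x y)

end VGraph

/-! ## Operads and `(V, P)`-categories -/

/-- `cut k i = k 0 + ⋯ + k (i - 1)`: the place where the `i`-th block starts when
`0, 1, …, k 0 + ⋯ + k (m - 1)` is cut into consecutive blocks of lengths `k 0, …, k (m - 1)`. -/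
def cut {m : ℕ} (k : Fin m → ℕ) (i : Fin (m + 1)) : ℕ :=
  ∑ j : Fin i, k (Fin.castLE (Nat.lt_succ_iff.1 i.2) j)

theorem cut_zero {m : ℕ} (k : Fin m → ℕ) : cut k 0 = 0 := by
  simp [cut]

theorem cut_last {m : ℕ} (k : Fin m → ℕ) : cut k (Fin.last m) = ∑ i, k i := rfl

theorem cut_succ {m : ℕ} (k : Fin m → ℕ) (i : Fin m) :
    cut k i.succ = cut k i.castSucc + k i :=
  Fin.sum_univ_castSucc (n := (i : ℕ)) _

theorem cut_add_lt {m : ℕ} {k : Fin m → ℕ} {N : ℕ} (h : ∑ i, k i = N) (i : Fin m)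
    (j : Fin (k i)) : cut k i.castSucc + j < N := by
  have h1 := (finSigmaFinEquiv (n := k) ⟨i, j⟩).2
  rw [finSigmaFinEquiv_apply] at h1
  exact h ▸ h1

theorem cut_add_lt_succ {m : ℕ} {k : Fin m → ℕ} {N : ℕ} (h : ∑ i, k i = N) (i : Fin m)
    (j : Fin (k i + 1)) : cut k i.castSucc + j < N + 1 := by
  rcases Nat.lt_or_ge (j : ℕ) (k i) with hj | hj
  · exact Nat.lt_succ_of_lt (cut_add_lt h i ⟨j, hj⟩)
  · have h0 : (j : ℕ) = k i := by omega
    rcases Nat.eq_zero_or_pos (k i) with hk | hk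
    · have h2 : cut k i.castSucc ≤ ∑ i, k i := by
        have h3 := Finset.sum_le_univ_sum_of_nonneg (f := k) (fun _ => Nat.zero_le _)
          (s := Finset.univ.map (Fin.castLEEmb (Nat.lt_succ_iff.1 i.castSucc.2)))
        rw [Finset.sum_map] at h3
        exact h3
      omega
    · have h2 := cut_add_lt h i ⟨k i - 1, by omega⟩
      simp only at h2
      omega

/-- The `j`-th entry of the `i`-th block. -/
def block {m : ℕ} {k : Fin m → ℕ} {N : ℕ} (h : ∑ i, k i = N) (i : Fin m) (j : Fin (k i)) :
    Fin N :=
  ⟨cut k i.castSucc + j, cut_add_lt h i j⟩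

/-- The `j`-th vertex of the `i`-th block (`0 ≤ j ≤ k i`). -/
def blockVertex {m : ℕ} {k : Fin m → ℕ} {N : ℕ} (h : ∑ i, k i = N) (i : Fin m)
    (j : Fin (k i + 1)) : Fin (N + 1) :=
  ⟨cut k i.castSucc + j, cut_add_lt_succ h i j⟩

/-- The vertices at which the blocks meet. -/
def cutVertex {m : ℕ} {k : Fin m → ℕ} {N : ℕ} (h : ∑ i, k i = N) (i : Fin (m + 1)) :
    Fin (N + 1) :=
  ⟨cut k i, by
    refine Fin.lastCases ?_ (fun i => ?_) i
    · rw [cut_last, h]; exact Nat.lt_succ_self N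
    · exact cut_add_lt_succ h i 0⟩

theorem blockVertex_zero {m : ℕ} {k : Fin m → ℕ} {N : ℕ} (h : ∑ i, k i = N) (i : Fin m) :
    blockVertex h i 0 = cutVertex h i.castSucc := rfl

theorem blockVertex_last {m : ℕ} {k : Fin m → ℕ} {N : ℕ} (h : ∑ i, k i = N) (i : Fin m) :
    blockVertex h i (Fin.last (k i)) = cutVertex h i.succ :=
  Fin.ext (cut_succ k i).symm

theorem cutVertex_zero {m : ℕ} {k : Fin m → ℕ} {N : ℕ} (h : ∑ i, k i = N) :
    cutVertex h 0 = 0 :=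
  Fin.ext (cut_zero k)

theorem cutVertex_last {m : ℕ} {k : Fin m → ℕ} {N : ℕ} (h : ∑ i, k i = N) :
    cutVertex h (Fin.last m) = Fin.last N :=
  Fin.ext ((cut_last k).trans h)

theorem sum_block {m : ℕ} {k : Fin m → ℕ} {N L : ℕ} (h : ∑ i, k i = N) (l : Fin N → ℕ)
    (hl : ∑ j, l j = L) : ∑ i, ∑ j, l (block h i j) = L := by
  subst h
  subst hl
  rw [← Equiv.sum_comp finSigmaFinEquiv l, Fintype.sum_sigma]
  refine Finset.sum_congr rfl fun i _ => Finset.sum_congr rfl fun j _ => congrArg l ?_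
  apply Fin.ext
  rw [finSigmaFinEquiv_apply]
  rfl

section Operads

variable {V : Type (u + 1)} [Category.{u} V]

/-- The family `Y, Z 0, …, Z (m - 1)`, whose product is `Y × Z 0 × ⋯ × Z (m - 1)`. -/
def consFam {m : ℕ} (Y : V) (Z : Fin m → V) : Option (Fin m) → V
  | none => Y
  | some i => Z i

/-- The family of morphisms `p, q 0, …, q (m - 1)`. -/
def consHom {m : ℕ} {X Y : V} {Z : Fin m → V} (p : X ⟶ Y) (q : ∀ i, X ⟶ Z i) :
    ∀ o, X ⟶ consFam Y Z o
  | none => p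
  | some i => q i

variable [HasFiniteProducts V]

/-- The morphism `(p, q 0, …, q (m - 1)) : X ⟶ Y × Z 0 × ⋯ × Z (m - 1)`. -/
noncomputable def tuple {m : ℕ} {X Y : V} {Z : Fin m → V} (p : X ⟶ Y) (q : ∀ i, X ⟶ Z i) :
    X ⟶ ∏ᶜ consFam Y Z :=
  Pi.lift (consHom p q)

theorem comp_tuple {m : ℕ} {X X' Y : V} {Z : Fin m → V} (e : X' ⟶ X) (p : X ⟶ Y)
    (q : ∀ i, X ⟶ Z i) : e ≫ tuple p q = tuple (e ≫ p) (fun i => e ≫ q i) := by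
  refine Pi.hom_ext _ _ fun o => ?_
  cases o <;> simp [tuple, consHom] <;> rfl

/-- The first projection of `Y × Z 0 × ⋯ × Z (m - 1)`. -/
noncomputable def headProj {m : ℕ} (Y : V) (Z : Fin m → V) : (∏ᶜ consFam Y Z) ⟶ Y :=
  Pi.π (consFam Y Z) none

/-- The other projections of `Y × Z 0 × ⋯ × Z (m - 1)`. -/
noncomputable def tailProj {m : ℕ} (Y : V) (Z : Fin m → V) (i : Fin m) :
    (∏ᶜ consFam Y Z) ⟶ Z i :=
  Pi.π (consFam Y Z) (some i)

theorem tuple_headProj {m : ℕ} {X Y : V} {Z : Fin m → V} (p : X ⟶ Y) (q : ∀ i, X ⟶ Z i) :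
    tuple p q ≫ headProj Y Z = p :=
  Pi.lift_π _ _

theorem tuple_tailProj {m : ℕ} {X Y : V} {Z : Fin m → V} (p : X ⟶ Y) (q : ∀ i, X ⟶ Z i)
    (i : Fin m) : tuple p q ≫ tailProj Y Z i = q i :=
  Pi.lift_π _ _

variable (V)

/-- A (classical, non-symmetric) operad in `V`, with respect to the cartesian product.
The composition is a morphism `P m × P (k 0) × ⋯ × P (k (m - 1)) ⟶ P N`, where
`N = k 0 + ⋯ + k (m - 1)`; the axioms are written with generalised elements. -/
structure Operad : Type (u + 1) where
  obj : ℕ → V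
  unit : ⊤_ V ⟶ obj 1
  comp : ∀ {m : ℕ} (k : Fin m → ℕ) {N : ℕ}, ∑ i, k i = N →
    ((∏ᶜ consFam (obj m) fun i => obj (k i)) ⟶ obj N)
  unit_comp : ∀ {X : V} {N : ℕ} (q : X ⟶ obj N),
    tuple (terminal.from X ≫ unit) (fun _ : Fin 1 => q) ≫
      comp (fun _ : Fin 1 => N) (by simp) = q
  comp_unit : ∀ {X : V} {m : ℕ} (p : X ⟶ obj m),
    tuple p (fun _ : Fin m => terminal.from X ≫ unit) ≫
      comp (fun _ : Fin m => 1) (by simp) = p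
  assoc : ∀ {X : V} {m : ℕ} (k : Fin m → ℕ) {N : ℕ} (hN : ∑ i, k i = N) (l : Fin N → ℕ)
    {L : ℕ} (hL : ∑ j, l j = L) (p : X ⟶ obj m) (q : ∀ i, X ⟶ obj (k i))
    (r : ∀ j, X ⟶ obj (l j)),
    tuple (tuple p q ≫ comp k hN) r ≫ comp l hL =
      tuple p (fun i => tuple (q i) (fun j => r (block hN i j)) ≫
        comp (fun j => l (block hN i j)) rfl) ≫
        comp (fun i => ∑ j, l (block hN i j)) (sum_block hN l hL)

variable {V}

/-- A `(V, P)`-category: a `V`-graph with, for all objects `x = a 0, …, a k = y`, a composition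
`P k × A (a 0, a 1) × ⋯ × A (a (k - 1), a k) ⟶ A (x, y)`, compatible with the unit and the
composition of the operad `P` (written with generalised elements). -/
structure VPCat (P : Operad V) : Type (u + 1) extends VGraph V where
  comp : ∀ {k : ℕ} (a : Fin (k + 1) → obj) {x y : obj}, a 0 = x → a (Fin.last k) = y →
    ((∏ᶜ consFam (P.obj k) fun i : Fin k => hom (a i.castSucc) (a i.succ)) ⟶ hom x y)
  unit_comp : ∀ {X : V} (a : Fin 2 → obj)
    (f : ∀ i : Fin 1, X ⟶ hom (a i.castSucc) (a i.succ)),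
    tuple (terminal.from X ≫ P.unit) f ≫ comp a rfl rfl = f 0
  assoc : ∀ {X : V} {m : ℕ} (k : Fin m → ℕ) {N : ℕ} (hN : ∑ i, k i = N)
    (a : Fin (N + 1) → obj) {x y : obj} (hx : a 0 = x) (hy : a (Fin.last N) = y)
    (p : X ⟶ P.obj m) (q : ∀ i, X ⟶ P.obj (k i))
    (f : ∀ j : Fin N, X ⟶ hom (a j.castSucc) (a j.succ)),
    tuple (tuple p q ≫ P.comp k hN) f ≫ comp a hx hy =
      tuple p (fun i =>
        tuple (q i) (fun j => f (block hN i j)) ≫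
          comp (fun j => a (blockVertex hN i j)) (congrArg a (blockVertex_zero hN i))
            (congrArg a (blockVertex_last hN i))) ≫
        comp (fun i => a (cutVertex hN i)) ((congrArg a (cutVertex_zero hN)).trans hx)
          ((congrArg a (cutVertex_last hN)).trans hy)

namespace VPCat

variable {P : Operad V}

/-- A morphism of `(V, P)`-categories: a morphism of the underlying `V`-graphs that commutes with
the compositions. -/
@[ext]
structure Hom (A B : VPCat P) : Type u where
  toGraph : A.toVGraph ⟶ B.toVGraph
  comm : ∀ {X : V} {k : ℕ} (a : Fin (k + 1) → A.obj) {x y : A.obj} (hx : a 0 = x)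
    (hy : a (Fin.last k) = y) (p : X ⟶ P.obj k)
    (f : ∀ i : Fin k, X ⟶ A.hom (a i.castSucc) (a i.succ)),
    (tuple p f ≫ A.comp a hx hy) ≫ VGraph.Hom.map toGraph x y =
      tuple p (fun i => f i ≫ VGraph.Hom.map toGraph _ _) ≫
        B.comp (fun i => VGraph.Hom.obj toGraph (a i))
          (congrArg (VGraph.Hom.obj toGraph) hx) (congrArg (VGraph.Hom.obj toGraph) hy)

instance : Category.{u} (VPCat P) where
  Hom A B := Hom A B
  id A := ⟨𝟙 A.toVGraph, fun a x y hx hy p f => by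
    change (tuple p f ≫ A.comp a hx hy) ≫ 𝟙 _ = tuple p (fun i => f i ≫ 𝟙 _) ≫ A.comp a hx hy
    simp⟩
  comp {A B C} F G := ⟨F.toGraph ≫ G.toGraph, fun a x y hx hy p f => by
    refine (Category.assoc _ _ _).symm.trans ?_
    refine (congrArg (fun e => e ≫ VGraph.Hom.map G.toGraph _ _) (F.comm a hx hy p f)).trans ?_
    refine (G.comm (fun i => VGraph.Hom.obj F.toGraph (a i))
      (congrArg (VGraph.Hom.obj F.toGraph) hx) (congrArg (VGraph.Hom.obj F.toGraph) hy) p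
      (fun i => f i ≫ VGraph.Hom.map F.toGraph _ _)).trans ?_
    simp only [Category.assoc]
    rfl⟩
  id_comp F := Hom.ext (Category.id_comp F.toGraph)
  comp_id F := Hom.ext (Category.comp_id F.toGraph)
  assoc F G H := Hom.ext (Category.assoc F.toGraph G.toGraph H.toGraph)

/-- The forgetful functor to `V`-graphs. -/
def forget (P : Operad V) : VPCat P ⥤ VGraph V where
  obj A := A.toVGraph
  map F := F.toGraph

section Products

variable {J : Type} [Finite J] (A : J → VPCat P)

/-- The composition in a product of `(V, P)`-categories. -/
noncomputable def piComp {k : ℕ} (a : Fin (k + 1) → ∀ j, (A j).obj) {x y : ∀ j, (A j).obj}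
    (hx : a 0 = x) (hy : a (Fin.last k) = y) :
    (∏ᶜ consFam (P.obj k) fun i : Fin k =>
      ∏ᶜ fun j => (A j).hom (a i.castSucc j) (a i.succ j)) ⟶ ∏ᶜ fun j => (A j).hom (x j) (y j) :=
  Pi.lift fun j =>
    tuple (headProj _ _) (fun i => tailProj _ _ i ≫ Pi.π _ j) ≫
      (A j).comp (fun i => a i j) (congrFun hx j) (congrFun hy j)

theorem tuple_piComp {X : V} {k : ℕ} (a : Fin (k + 1) → ∀ j, (A j).obj)
    {x y : ∀ j, (A j).obj} (hx : a 0 = x) (hy : a (Fin.last k) = y) (p : X ⟶ P.obj k)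
    (f : ∀ i : Fin k, X ⟶ ∏ᶜ fun j => (A j).hom (a i.castSucc j) (a i.succ j)) (j : J) :
    (tuple p f ≫ piComp A a hx hy) ≫ Pi.π _ j =
      tuple p (fun i => f i ≫ Pi.π _ j) ≫
        (A j).comp (fun i => a i j) (congrFun hx j) (congrFun hy j) := by
  rw [Category.assoc, piComp, Pi.lift_π, ← Category.assoc, comp_tuple]
  simp only [← Category.assoc, tuple_headProj, tuple_tailProj]

/-- The product of a finite family of `(V, P)`-categories. -/
noncomputable def pi : VPCat P where
  obj := ∀ j, (A j).obj
  hom x y := ∏ᶜ fun j => (A j).hom (x j) (y j)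
  comp a _ _ hx hy := piComp A a hx hy
  unit_comp {X} a f := by
    refine Pi.hom_ext _ _ fun j => ?_
    rw [tuple_piComp]
    exact (A j).unit_comp (fun i => a i j) fun i => f i ≫ Pi.π _ j
  assoc {X} m k N hN a x y hx hy p q f := by
    refine Pi.hom_ext _ _ fun j => ?_
    refine (tuple_piComp A a hx hy (tuple p q ≫ P.comp k hN) f j).trans ?_
    refine Eq.trans ?_ (tuple_piComp A (fun i => a (cutVertex hN i))
      ((congrArg a (cutVertex_zero hN)).trans hx)
      ((congrArg a (cutVertex_last hN)).trans hy) p _ j).symm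
    refine ((A j).assoc k hN (fun i => a i j) (congrFun hx j) (congrFun hy j) p q
      fun i => f i ≫ Pi.π _ j).trans ?_
    refine congrArg (fun g => tuple p g ≫ _) (funext fun i => ?_)
    exact (tuple_piComp A (fun j => a (blockVertex hN i j)) (congrArg a (blockVertex_zero hN i))
      (congrArg a (blockVertex_last hN i)) (q i) (fun j => f (block hN i j)) j).symm

/-- The projections of the product. -/
noncomputable def piProj (j : J) : pi A ⟶ A j where
  toGraph := ⟨fun x => x j, fun _ _ => Pi.π _ j⟩
  comm a _ _ hx hy p f := tuple_piComp A a hx hy p f j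

/-- The morphism into the product induced by a family of morphisms. -/
noncomputable def piLift {B : VPCat P} (F : ∀ j, B ⟶ A j) : B ⟶ pi A where
  toGraph := ⟨fun x j => VGraph.Hom.obj (Hom.toGraph (F j)) x,
    fun x y => Pi.lift fun j => VGraph.Hom.map (Hom.toGraph (F j)) x y⟩
  comm {X k} a x y hx hy p f := by
    refine Pi.hom_ext _ _ fun j => ?_
    refine Eq.trans ?_ (tuple_piComp A (fun i j => VGraph.Hom.obj (Hom.toGraph (F j)) (a i))
      (funext fun j => congrArg (VGraph.Hom.obj (Hom.toGraph (F j))) hx)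
      (funext fun j => congrArg (VGraph.Hom.obj (Hom.toGraph (F j))) hy) p
      (fun i => f i ≫ Pi.lift fun j =>
        VGraph.Hom.map (Hom.toGraph (F j)) (a i.castSucc) (a i.succ)) j).symm
    simp only [Category.assoc, Pi.lift_π]
    refine (Category.assoc _ _ _).trans ?_
    refine (congrArg (fun e => (tuple p f ≫ B.comp a hx hy) ≫ e) (Pi.lift_π _ j)).trans ?_
    exact Hom.comm (F j) a hx hy p f

theorem piLift_piProj {B : VPCat P} (F : ∀ j, B ⟶ A j) (j : J) :
    piLift A F ≫ piProj A j = F j :=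
  Hom.ext (VGraph.hom_eq fun _ _ => Pi.lift_π _ _)

theorem eq_piLift {B : VPCat P} (G : B ⟶ pi A) : G = piLift A fun j => G ≫ piProj A j :=
  Hom.ext (VGraph.hom_eq fun x y => Pi.hom_ext _ _ fun j =>
    (Pi.lift_π (fun j => VGraph.Hom.map (Hom.toGraph (G ≫ piProj A j)) x y) j).symm)

/-- `pi A` is a product of the `A j`. -/
noncomputable def piIsLimit : IsLimit (Fan.mk (pi A) (piProj A)) :=
  Fan.IsLimit.mk _ (fun s => piLift A fun j => s.proj j)
    (fun s j => piLift_piProj A (fun j => s.proj j) j)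
    (fun _ m hm => (eq_piLift A m).trans (congrArg (piLift A) (funext hm)))

instance : HasFiniteProducts (VPCat P) where
  out n := ⟨fun K => by
    let e : Discrete.functor (fun i : Fin n => K.obj ⟨i⟩) ≅ K :=
      Discrete.natIso fun _ => Iso.refl _
    have : HasLimit (Discrete.functor fun i : Fin n => K.obj ⟨i⟩) :=
      ⟨⟨⟨_, piIsLimit fun i : Fin n => K.obj ⟨i⟩⟩⟩⟩
    exact hasLimit_of_iso e⟩

end Products

end VPCat

end Operads

/-! ## Products and coproducts in the categories of `n`-graphs -/

/-- A category with a choice of all (`u`-small) coproducts. -/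
class Coproducts (V : Type (u + 1)) [Category.{u} V] where
  sigma : ∀ {ι : Type u}, (ι → V) → V
  inj : ∀ {ι : Type u} (f : ι → V) (i : ι), f i ⟶ sigma f
  isColimit : ∀ {ι : Type u} (f : ι → V), IsColimit (Cofan.mk (sigma f) (inj f))

/-- A category with a choice of products indexed by types in the lowest universe, such as
`Fin k`. -/
class Products (V : Type (u + 1)) [Category.{u} V] where
  pi : ∀ {ι : Type}, (ι → V) → V
  proj : ∀ {ι : Type} (f : ι → V) (i : ι), pi f ⟶ f i
  isLimit : ∀ {ι : Type} (f : ι → V), IsLimit (Fan.mk (pi f) (proj f))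

section Chosen

variable {V : Type (u + 1)} [Category.{u} V]

namespace Coproducts

variable [Coproducts V] {ι : Type u} {f : ι → V} {X : V}

def desc (g : ∀ i, f i ⟶ X) : sigma f ⟶ X :=
  Cofan.IsColimit.desc (isColimit f) g

theorem inj_desc (g : ∀ i, f i ⟶ X) (i : ι) : inj f i ≫ desc g = g i :=
  Cofan.IsColimit.fac (isColimit f) g i

theorem hom_ext {g h : sigma f ⟶ X} (e : ∀ i, inj f i ≫ g = inj f i ≫ h) : g = h :=
  Cofan.IsColimit.hom_ext (isColimit f) g h e

end Coproducts

namespace Products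

variable [Products V] {ι : Type} {f : ι → V} {X : V}

def lift (g : ∀ i, X ⟶ f i) : X ⟶ pi f :=
  Fan.IsLimit.lift (isLimit f) g

theorem lift_proj (g : ∀ i, X ⟶ f i) (i : ι) : lift g ≫ proj f i = g i :=
  Fan.IsLimit.fac (isLimit f) g i

theorem hom_ext {g h : X ⟶ pi f} (e : ∀ i, g ≫ proj f i = h ≫ proj f i) : g = h :=
  Fan.IsLimit.hom_ext (isLimit f) g h e

end Products

end Chosen

/-- The coproduct of sets is the disjoint union. -/
instance : Coproducts (Type u) where
  sigma f := Σ i, f i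
  inj _ i := TypeCat.ofHom fun x => ⟨i, x⟩
  isColimit _ := Cofan.IsColimit.mk _ (fun s => TypeCat.ofHom fun x => s.inj x.1 x.2)
    (fun _ _ => rfl)
    (fun s m h => by
      ext x
      exact ConcreteCategory.congr_hom (h x.1) x.2)

/-- The product of sets. -/
instance : Products (Type u) where
  pi f := ∀ i, f i
  proj _ i := TypeCat.ofHom fun x => x i
  isLimit _ := Fan.IsLimit.mk _ (fun s => TypeCat.ofHom fun x i => s.proj i x)
    (fun _ _ => rfl)
    (fun s m h => by
      ext x
      funext i
      exact ConcreteCategory.congr_hom (h i) x)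

namespace VGraph

variable {V : Type (u + 1)} [Category.{u} V]

section GraphProducts

variable [Products V] {ι : Type} (f : ι → VGraph V)

/-- In a product of `V`-graphs, objects and hom-objects are products. -/
def piGraph : VGraph V :=
  ⟨∀ i, (f i).obj, fun x y => Products.pi fun i => (f i).hom (x i) (y i)⟩

def piGraphProj (i : ι) : piGraph f ⟶ f i :=
  ⟨fun x => x i, fun x y => Products.proj (fun i => (f i).hom (x i) (y i)) i⟩

def piGraphLift {X : VGraph V} (g : ∀ i, X ⟶ f i) : X ⟶ piGraph f :=
  ⟨fun x i => Hom.obj (g i) x, fun x y => Products.lift fun i => Hom.map (g i) x y⟩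

theorem piGraphLift_proj {X : VGraph V} (g : ∀ i, X ⟶ f i) (i : ι) :
    piGraphLift f g ≫ piGraphProj f i = g i :=
  hom_eq fun _ _ => Products.lift_proj _ _

theorem eq_piGraphLift {X : VGraph V} (m : X ⟶ piGraph f) :
    m = piGraphLift f fun i => m ≫ piGraphProj f i :=
  hom_eq fun x y => Products.hom_ext fun i =>
    (Products.lift_proj (fun i => Hom.map (m ≫ piGraphProj f i) x y) i).symm

end GraphProducts

instance [Products V] : Products (VGraph V) where
  pi f := piGraph f
  proj f i := piGraphProj f i
  isLimit f := Fan.IsLimit.mk _ (fun s => piGraphLift f fun i => s.proj i)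
    (fun s i => piGraphLift_proj f (fun i => s.proj i) i)
    (fun _ m h => (eq_piGraphLift f m).trans (congrArg (piGraphLift f) (funext h)))

section GraphCoproducts

variable [Coproducts V] {ι : Type u} (f : ι → VGraph V)

/-- The hom-objects of a disjoint union of `V`-graphs: `(f i).hom x y` for `x`, `y` in the same
summand `i`, and an empty coproduct for `x`, `y` in different summands. -/
def sigmaGraphHom (p q : Σ i, (f i).obj) : V :=
  Coproducts.sigma fun h : ULift.{u} (PLift (p.1 = q.1)) => (f q.1).hom (h.down.down ▸ p.2) q.2

/-- The disjoint union of a family of `V`-graphs. -/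
def sigmaGraph : VGraph V :=
  ⟨Σ i, (f i).obj, sigmaGraphHom f⟩

def sigmaGraphInj (i : ι) : f i ⟶ sigmaGraph f :=
  ⟨fun x => ⟨i, x⟩, fun x y => Coproducts.inj
    (fun h : ULift.{u} (PLift (i = i)) => (f i).hom (h.down.down ▸ x) y) ⟨⟨rfl⟩⟩⟩

def sigmaGraphDescHom {X : VGraph V} (g : ∀ i, f i ⟶ X) (p q : Σ i, (f i).obj)
    (h : ULift.{u} (PLift (p.1 = q.1))) : (f q.1).hom (h.down.down ▸ p.2) q.2 ⟶
      X.hom (Hom.obj (g p.1) p.2) (Hom.obj (g q.1) q.2) :=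
  match p, q, h with
  | ⟨i, x⟩, ⟨_, y⟩, ⟨⟨rfl⟩⟩ => Hom.map (g i) x y

def sigmaGraphDesc {X : VGraph V} (g : ∀ i, f i ⟶ X) : sigmaGraph f ⟶ X :=
  ⟨fun p => Hom.obj (g p.1) p.2, fun p q => Coproducts.desc (sigmaGraphDescHom f g p q)⟩

theorem sigmaGraphInj_desc {X : VGraph V} (g : ∀ i, f i ⟶ X) (i : ι) :
    sigmaGraphInj f i ≫ sigmaGraphDesc f g = g i :=
  hom_eq fun _ _ => Coproducts.inj_desc _ _

theorem eq_sigmaGraphDesc {X : VGraph V} (m : sigmaGraph f ⟶ X) :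
    m = sigmaGraphDesc f fun i => sigmaGraphInj f i ≫ m :=
  hom_eq fun p q => Coproducts.hom_ext fun h => by
    obtain ⟨i, x⟩ := p
    obtain ⟨j, y⟩ := q
    obtain ⟨⟨h⟩⟩ := h
    obtain rfl : i = j := h
    exact (Coproducts.inj_desc (sigmaGraphDescHom f (fun i => sigmaGraphInj f i ≫ m)
      ⟨i, x⟩ ⟨i, y⟩) ⟨⟨rfl⟩⟩).symm

end GraphCoproducts

instance [Coproducts V] : Coproducts (VGraph V) where
  sigma f := sigmaGraph f
  inj f i := sigmaGraphInj f i
  isColimit f := Cofan.IsColimit.mk _ (fun s => sigmaGraphDesc f fun i => s.inj i)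
    (fun s i => sigmaGraphInj_desc f (fun i => s.inj i) i)
    (fun _ m h => (eq_sigmaGraphDesc f m).trans (congrArg (sigmaGraphDesc f) (funext h)))

end VGraph

/-! ## Free `V`-categories and free `(V, P)`-categories -/

section Free

variable {V : Type (u + 1)} [Category.{u} V]

/-- The strings `x = a 0, a 1, …, a k = y` of objects of a `V`-graph, for all `k ≥ 0`. -/
structure Chain (A : VGraph V) (x y : A.obj) : Type u where
  length : ℕ
  vertex : Fin (length + 1) → A.obj
  first : vertex 0 = x
  last : vertex (Fin.last length) = y

/-- The hom-objects `A (a 0, a 1), …, A (a (k - 1), a k)` along a string. -/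
def Chain.edge {A : VGraph V} {x y : A.obj} (c : Chain A x y) (i : Fin c.length) : V :=
  A.hom (c.vertex i.castSucc) (c.vertex i.succ)

/-- The image of a string under a morphism of `V`-graphs. -/
def Chain.map {A B : VGraph V} (f : A ⟶ B) {x y : A.obj} (c : Chain A x y) :
    Chain B (VGraph.Hom.obj f x) (VGraph.Hom.obj f y) where
  length := c.length
  vertex i := VGraph.Hom.obj f (c.vertex i)
  first := congrArg _ c.first
  last := congrArg _ c.last

def Chain.edgeMap {A B : VGraph V} (f : A ⟶ B) {x y : A.obj} (c : Chain A x y)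
    (i : Fin c.length) : c.edge i ⟶ (c.map f).edge i :=
  VGraph.Hom.map f _ _

section Products

variable [Products V]

/-- The product `A (a 0, a 1) × ⋯ × A (a (k - 1), a k)` along a string. -/
def Chain.prod {A : VGraph V} {x y : A.obj} (c : Chain A x y) : V :=
  Products.pi c.edge

def Chain.prodMap {A B : VGraph V} (f : A ⟶ B) {x y : A.obj} (c : Chain A x y) :
    c.prod ⟶ (c.map f).prod :=
  Products.lift fun i => Products.proj c.edge i ≫ c.edgeMap f i

theorem Chain.prodMap_id {A : VGraph V} {x y : A.obj} (c : Chain A x y) :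
    c.prodMap (𝟙 A) = 𝟙 c.prod :=
  Products.hom_ext fun i => (Products.lift_proj _ i).trans
    ((Category.comp_id _).trans (Category.id_comp _).symm)

theorem Chain.prodMap_comp {A B C : VGraph V} (f : A ⟶ B) (g : B ⟶ C) {x y : A.obj}
    (c : Chain A x y) : c.prodMap (f ≫ g) = c.prodMap f ≫ (c.map f).prodMap g :=
  Products.hom_ext fun i => (Products.lift_proj _ i).trans <| Eq.symm <| by
    refine (Category.assoc _ _ _).trans ?_
    refine (congrArg (fun e => c.prodMap f ≫ e) (Products.lift_proj _ i)).trans ?_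
    refine (Category.assoc _ _ _).symm.trans ?_
    refine (congrArg (fun e => e ≫ (c.map f).edgeMap g i) (Products.lift_proj _ i)).trans ?_
    exact Category.assoc _ _ _

/-- The product `P k × A (a 0, a 1) × ⋯ × A (a (k - 1), a k)` along a string. -/
def Chain.opProd (P : ℕ → V) {A : VGraph V} {x y : A.obj} (c : Chain A x y) : V :=
  Products.pi (consFam (P c.length) c.edge)

def Chain.opHead (P : ℕ → V) {A : VGraph V} {x y : A.obj} (c : Chain A x y) :
    c.opProd P ⟶ P c.length :=
  Products.proj (consFam (P c.length) c.edge) none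

def Chain.opTail (P : ℕ → V) {A : VGraph V} {x y : A.obj} (c : Chain A x y)
    (i : Fin c.length) : c.opProd P ⟶ c.edge i :=
  Products.proj (consFam (P c.length) c.edge) (some i)

def Chain.opLift (P : ℕ → V) {A : VGraph V} {x y : A.obj} (c : Chain A x y) {X : V}
    (p : X ⟶ P c.length) (q : ∀ i, X ⟶ c.edge i) : X ⟶ c.opProd P :=
  Products.lift (consHom p q)

theorem Chain.opLift_opHead (P : ℕ → V) {A : VGraph V} {x y : A.obj} (c : Chain A x y) {X : V}
    (p : X ⟶ P c.length) (q : ∀ i, X ⟶ c.edge i) : c.opLift P p q ≫ c.opHead P = p :=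
  Products.lift_proj (consHom p q) none

theorem Chain.opLift_opTail (P : ℕ → V) {A : VGraph V} {x y : A.obj} (c : Chain A x y) {X : V}
    (p : X ⟶ P c.length) (q : ∀ i, X ⟶ c.edge i) (i : Fin c.length) :
    c.opLift P p q ≫ c.opTail P i = q i :=
  Products.lift_proj (consHom p q) (some i)

theorem Chain.opProd_ext (P : ℕ → V) {A : VGraph V} {x y : A.obj} (c : Chain A x y) {X : V}
    {g h : X ⟶ c.opProd P} (e : g ≫ c.opHead P = h ≫ c.opHead P)
    (e' : ∀ i, g ≫ c.opTail P i = h ≫ c.opTail P i) : g = h :=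
  Products.hom_ext fun o => match o with
    | none => e
    | some i => e' i

def Chain.opProdMap (P : ℕ → V) {A B : VGraph V} (f : A ⟶ B) {x y : A.obj} (c : Chain A x y) :
    c.opProd P ⟶ (c.map f).opProd P :=
  (c.map f).opLift P (c.opHead P) fun i => c.opTail P i ≫ c.edgeMap f i

theorem Chain.opProdMap_id (P : ℕ → V) {A : VGraph V} {x y : A.obj} (c : Chain A x y) :
    c.opProdMap P (𝟙 A) = 𝟙 (c.opProd P) :=
  c.opProd_ext P ((Chain.opLift_opHead P (c.map (𝟙 A)) _ _).trans (Category.id_comp _).symm)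
    fun i => (Chain.opLift_opTail P (c.map (𝟙 A)) _ _ i).trans
      ((Category.comp_id _).trans (Category.id_comp _).symm)

theorem Chain.opProdMap_comp (P : ℕ → V) {A B C : VGraph V} (f : A ⟶ B) (g : B ⟶ C)
    {x y : A.obj} (c : Chain A x y) :
    c.opProdMap P (f ≫ g) = c.opProdMap P f ≫ (c.map f).opProdMap P g := by
  refine Chain.opProd_ext P (c.map (f ≫ g)) ?_ fun i => ?_
  · refine (Chain.opLift_opHead P _ _ _).trans ?_
    refine Eq.symm ((Category.assoc _ _ _).trans ?_)
    refine (congrArg (fun e => c.opProdMap P f ≫ e)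
      (Chain.opLift_opHead P ((c.map f).map g) _ _)).trans ?_
    exact Chain.opLift_opHead P (c.map f) _ _
  · refine (Chain.opLift_opTail P _ _ _ i).trans ?_
    refine Eq.symm ((Category.assoc _ _ _).trans ?_)
    refine (congrArg (fun e => c.opProdMap P f ≫ e)
      (Chain.opLift_opTail P ((c.map f).map g) _ _ i)).trans ?_
    refine (Category.assoc _ _ _).symm.trans ?_
    refine (congrArg (fun e => e ≫ (c.map f).edgeMap g i)
      (Chain.opLift_opTail P (c.map f) _ _ i)).trans ?_
    exact Category.assoc _ _ _

/-- The projection that forgets the factor `P k`. -/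
def Chain.forgetHead (P : ℕ → V) {A : VGraph V} {x y : A.obj} (c : Chain A x y) :
    c.opProd P ⟶ c.prod :=
  Products.lift (c.opTail P)

theorem Chain.opProdMap_forgetHead (P : ℕ → V) {A B : VGraph V} (f : A ⟶ B) {x y : A.obj}
    (c : Chain A x y) :
    c.opProdMap P f ≫ (c.map f).forgetHead P = c.forgetHead P ≫ c.prodMap f := by
  refine Products.hom_ext fun i => ?_
  refine (Category.assoc _ _ _).trans (Eq.trans ?_ (Category.assoc _ _ _).symm)
  refine (congrArg (fun e => c.opProdMap P f ≫ e) (Products.lift_proj _ i)).trans ?_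
  refine (Chain.opLift_opTail P (c.map f) _ _ i).trans (Eq.symm ?_)
  refine (congrArg (fun e => c.forgetHead P ≫ e) (Products.lift_proj _ i)).trans ?_
  refine (Category.assoc _ _ _).symm.trans ?_
  exact congrArg (fun e => e ≫ c.edgeMap f i) (Products.lift_proj _ i)

end Products

variable [Coproducts V] [Products V]

/-- The free `V`-category on a `V`-graph `A` has the same objects, and as hom-objects the
coproducts over all strings `x = a 0, …, a k = y` of the products
`A (a 0, a 1) × ⋯ × A (a (k - 1), a k)`. -/
def fcObj (A : VGraph V) : VGraph V :=
  ⟨A.obj, fun x y => Coproducts.sigma fun c : Chain A x y => c.prod⟩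

/-- The inclusion of the summand of a string. -/
def fcInj {A : VGraph V} {x y : A.obj} (c : Chain A x y) : c.prod ⟶ (fcObj A).hom x y :=
  Coproducts.inj (fun c : Chain A x y => c.prod) c

/-- The components of `fc_V f` on hom-objects. -/
def fcHom {A B : VGraph V} (f : A ⟶ B) (x y : A.obj) : (fcObj A).hom x y ⟶
    (fcObj B).hom (VGraph.Hom.obj (B := B) f x) (VGraph.Hom.obj (B := B) f y) :=
  Coproducts.desc fun c : Chain A x y => c.prodMap f ≫ fcInj (c.map f)

theorem fcInj_hom {A B : VGraph V} (f : A ⟶ B) {x y : A.obj} (c : Chain A x y) :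
    fcInj c ≫ fcHom f x y = c.prodMap f ≫ fcInj (c.map f) :=
  Coproducts.inj_desc _ c

theorem fcHom_id (A : VGraph V) (x y : A.obj) :
    fcHom (𝟙 A) x y = 𝟙 ((fcObj A).hom x y) := by
  refine Coproducts.hom_ext fun c => (fcInj_hom (𝟙 A) c).trans ?_
  rw [Chain.prodMap_id]
  exact (Category.id_comp _).trans (Category.comp_id _).symm

theorem fcHom_comp {A B C : VGraph V} (f : A ⟶ B) (g : B ⟶ C) (x y : A.obj) :
    fcHom (f ≫ g) x y = fcHom f x y ≫ fcHom g _ _ := by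
  refine Coproducts.hom_ext fun c => (fcInj_hom (f ≫ g) c).trans ?_
  rw [Chain.prodMap_comp]
  refine Eq.symm ((Category.assoc _ _ _).symm.trans ?_)
  refine (congrArg (fun e => e ≫ fcHom g _ _) (fcInj_hom f c)).trans ?_
  refine (Category.assoc _ _ _).trans (Eq.trans ?_ (Category.assoc _ _ _).symm)
  exact congrArg (fun e => c.prodMap f ≫ e) (fcInj_hom g (c.map f))

/-- The underlying functor `fc_V` of the free `V`-category monad. -/
def fc : VGraph V ⥤ VGraph V where
  obj A := fcObj A
  map {A B} f := ⟨fun x => VGraph.Hom.obj (A := A) (B := B) f x, fun x y => fcHom f x y⟩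
  map_id A := VGraph.hom_eq fun x y => fcHom_id A x y
  map_comp f g := VGraph.hom_eq fun x y => fcHom_comp f g x y

/-- The free `(V, P)`-category on a `V`-graph `A`, for an operad in `V` with underlying objects
`P 0, P 1, …`, has the same objects, and as hom-objects the coproducts over all strings
`x = a 0, …, a k = y` of the products `P k × A (a 0, a 1) × ⋯ × A (a (k - 1), a k)`. -/
def fcOperadObj (P : ℕ → V) (A : VGraph V) : VGraph V :=
  ⟨A.obj, fun x y => Coproducts.sigma fun c : Chain A x y => c.opProd P⟩

/-- The inclusion of the summand of a string. -/
def fcOperadInj (P : ℕ → V) {A : VGraph V} {x y : A.obj} (c : Chain A x y) : c.opProd P ⟶ (fcOperadObj P A).hom x y :=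
  Coproducts.inj (fun c : Chain A x y => c.opProd P) c

/-- The components of `fc_(V, P) f` on hom-objects. -/
def fcOperadHom (P : ℕ → V) {A B : VGraph V} (f : A ⟶ B) (x y : A.obj) : (fcOperadObj P A).hom x y ⟶
    (fcOperadObj P B).hom (VGraph.Hom.obj (B := B) f x) (VGraph.Hom.obj (B := B) f y) :=
  Coproducts.desc fun c : Chain A x y => c.opProdMap P f ≫ fcOperadInj P (c.map f)

theorem fcOperadInj_hom (P : ℕ → V) {A B : VGraph V} (f : A ⟶ B) {x y : A.obj} (c : Chain A x y) :
    fcOperadInj P c ≫ fcOperadHom P f x y = c.opProdMap P f ≫ fcOperadInj P (c.map f) :=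
  Coproducts.inj_desc _ c

theorem fcOperadHom_id (P : ℕ → V) (A : VGraph V) (x y : A.obj) :
    fcOperadHom P (𝟙 A) x y = 𝟙 ((fcOperadObj P A).hom x y) := by
  refine Coproducts.hom_ext fun c => (fcOperadInj_hom P (𝟙 A) c).trans ?_
  rw [Chain.opProdMap_id]
  exact (Category.id_comp _).trans (Category.comp_id _).symm

theorem fcOperadHom_comp (P : ℕ → V) {A B C : VGraph V} (f : A ⟶ B) (g : B ⟶ C) (x y : A.obj) :
    fcOperadHom P (f ≫ g) x y = fcOperadHom P f x y ≫ fcOperadHom P g _ _ := by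
  refine Coproducts.hom_ext fun c => (fcOperadInj_hom P (f ≫ g) c).trans ?_
  rw [Chain.opProdMap_comp]
  refine Eq.symm ((Category.assoc _ _ _).symm.trans ?_)
  refine (congrArg (fun e => e ≫ fcOperadHom P g _ _) (fcOperadInj_hom P f c)).trans ?_
  refine (Category.assoc _ _ _).trans (Eq.trans ?_ (Category.assoc _ _ _).symm)
  exact congrArg (fun e => c.opProdMap P f ≫ e) (fcOperadInj_hom P g (c.map f))

/-- The underlying functor `fc_(V, P)` of the free `(V, P)`-category monad. -/
def fcOperad (P : ℕ → V) : VGraph V ⥤ VGraph V where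
  obj A := fcOperadObj P A
  map {A B} f := ⟨fun x => VGraph.Hom.obj (A := A) (B := B) f x, fun x y => fcOperadHom P f x y⟩
  map_id A := VGraph.hom_eq fun x y => fcOperadHom_id P A x y
  map_comp f g := VGraph.hom_eq fun x y => fcOperadHom_comp P f g x y

/-- The components of the projection from `fc_(V, P)` to `fc_V`. -/
def fcProjHom (P : ℕ → V) (A : VGraph V) (x y : A.obj) :
    (fcOperadObj P A).hom x y ⟶ (fcObj A).hom x y :=
  Coproducts.desc fun c : Chain A x y => c.forgetHead P ≫ fcInj c

theorem fcOperadInj_fcProjHom (P : ℕ → V) {A : VGraph V} {x y : A.obj} (c : Chain A x y) :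
    fcOperadInj P c ≫ fcProjHom P A x y = c.forgetHead P ≫ fcInj c :=
  Coproducts.inj_desc _ c

theorem fcProjHom_naturality (P : ℕ → V) {A B : VGraph V} (f : A ⟶ B) (x y : A.obj) :
    fcOperadHom P f x y ≫ fcProjHom P B _ _ = fcProjHom P A x y ≫ fcHom f x y := by
  refine Coproducts.hom_ext fun c => ?_
  refine (Category.assoc _ _ _).symm.trans ?_
  refine (congrArg (fun e => e ≫ fcProjHom P B _ _) (fcOperadInj_hom P f c)).trans ?_
  refine (Category.assoc _ _ _).trans ?_
  refine (congrArg (fun e => c.opProdMap P f ≫ e) (fcOperadInj_fcProjHom P (c.map f))).trans ?_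
  refine (Category.assoc _ _ _).symm.trans ?_
  rw [Chain.opProdMap_forgetHead]
  refine Eq.symm ((Category.assoc _ _ _).symm.trans ?_)
  refine (congrArg (fun e => e ≫ fcHom f x y) (fcOperadInj_fcProjHom P c)).trans ?_
  refine (Category.assoc _ _ _).trans (Eq.trans ?_ (Category.assoc _ _ _).symm)
  exact congrArg (fun e => c.forgetHead P ≫ e) (fcInj_hom f c)

/-- The natural transformation from `fc_(V, P)` to `fc_V` that forgets the factors `P k`. -/
def fcProj (P : ℕ → V) : fcOperad P ⟶ fc where
  app A := ⟨fun (x : A.obj) => x, fun x y => fcProjHom P A x y⟩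
  naturality _ _ f := VGraph.hom_eq fun x y => fcProjHom_naturality P f x y

end Free

/-! ## `n`-graphs and their cells -/

/-- The category of `n`-graphs: sets for `n = 0`, and graphs enriched in `(n - 1)`-graphs for
`n > 0`. It is equivalent to the category of `n`-globular sets. -/
def nGph : ℕ → Cat.{u, u + 1}
  | 0 => Cat.of (Type u)
  | n + 1 => Cat.of (VGraph (nGph n))

instance nGphCoproducts : ∀ n, Coproducts (nGph.{u} n)
  | 0 => inferInstanceAs (Coproducts (Type u))
  | n + 1 => by
    have := nGphCoproducts n
    exact inferInstanceAs (Coproducts (VGraph (nGph n)))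

instance nGphProducts : ∀ n, Products (nGph.{u} n)
  | 0 => inferInstanceAs (Products (Type u))
  | n + 1 => by
    have := nGphProducts n
    exact inferInstanceAs (Products (VGraph (nGph n)))

/-- The terminal `n`-graph. -/
def one : (n : ℕ) → nGph.{u} n
  | 0 => (PUnit : Type u)
  | n + 1 => (⟨PUnit, fun _ _ => one n⟩ : VGraph (nGph n))

/-- `one n` is a terminal object. -/
def oneIsTerminal : ∀ n, IsTerminal (one.{u} n)
  | 0 => Types.isTerminalPUnit
  | n + 1 => IsTerminal.ofUniqueHom (C := VGraph (nGph.{u} n)) (Y := one (n + 1))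
      (fun A => (⟨fun _ => PUnit.unit, fun x y => (oneIsTerminal n).from (A.hom x y)⟩ :
        VGraph.Hom A (one (n + 1))))
      (fun _ _ => VGraph.hom_eq fun _ _ => (oneIsTerminal n).hom_ext _ _)

/-- The set of `m`-cells of the globular set corresponding to an `n`-graph. -/
def Cell : (n m : ℕ) → nGph.{u} n → Type u
  | 0, 0, A => (A : Type u)
  | 0, _ + 1, _ => PEmpty
  | n + 1, 0, A => VGraph.obj (V := nGph n) A
  | n + 1, m + 1, A => Σ x y : VGraph.obj (V := nGph n) A, Cell n m (VGraph.hom (V := nGph n) A x y)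

namespace Cell

/-- The function underlying a morphism in the category of sets. -/
def applyFun {A B : Type u} (f : A ⟶ B) (c : A) : B := f c

/-- The action of a morphism of `n`-graphs on cells. -/
def map : {n m : ℕ} → {A B : nGph.{u} n} → (A ⟶ B) → Cell n m A → Cell n m B
  | 0, 0, _, _, f, c => applyFun f c
  | 0, _ + 1, _, _, _, c => PEmpty.elim c
  | n + 1, 0, _, _, f, c => VGraph.Hom.obj (V := nGph n) f c
  | n + 1, _ + 1, _, _, f, ⟨x, y, c⟩ =>
    ⟨VGraph.Hom.obj (V := nGph n) f x, VGraph.Hom.obj (V := nGph n) f y,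
      map (VGraph.Hom.map (V := nGph n) f x y) c⟩

/-- The source of a cell. -/
def src : {n m : ℕ} → {A : nGph.{u} n} → Cell n (m + 1) A → Cell n m A
  | 0, _, _, c => PEmpty.elim c
  | _ + 1, 0, _, ⟨x, _, _⟩ => x
  | _ + 1, _ + 1, _, ⟨x, y, c⟩ => ⟨x, y, src c⟩

/-- The target of a cell. -/
def tgt : {n m : ℕ} → {A : nGph.{u} n} → Cell n (m + 1) A → Cell n m A
  | 0, _, _, c => PEmpty.elim c
  | _ + 1, 0, _, ⟨_, y, _⟩ => y
  | _ + 1, _ + 1, _, ⟨x, y, c⟩ => ⟨x, y, tgt c⟩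

/-- The summand in which a cell of a coproduct lies, and the corresponding cell of that summand. -/
def ofSigma : {n m : ℕ} → {ι : Type u} → {f : ι → nGph.{u} n} →
    Cell n m (Coproducts.sigma f) → Σ i, Cell n m (f i)
  | 0, 0, _, _, c => c
  | 0, _ + 1, _, _, c => PEmpty.elim c
  | _ + 1, 0, _, _, c => c
  | _ + 1, _ + 1, _, _, ⟨p, q, c⟩ =>
    let d := ofSigma c
    ⟨q.1, d.1.down.down ▸ p.2, q.2, d.2⟩

end Cell

/-! ## Iterated enrichment and the functors `Q^(n)`, `T^(n)` -/

/-- A category with finite products, bundled. -/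
structure Base : Type (u + 2) where
  carrier : Type (u + 1)
  [category : Category.{u} carrier]
  [products : HasFiniteProducts carrier]

attribute [instance] Base.category Base.products

/-- The category of sets. -/
def Base.set : Base.{u} := ⟨Type u⟩

/-- The category of `(V, P)`-categories. -/
def Base.vpCat (V : Base.{u}) (P : Operad V.carrier) : Base.{u} := ⟨VPCat P⟩

/-- The identity functor between equal categories. -/
def Base.ofEq {V W : Base.{u}} (h : V = W) : V.carrier ⥤ W.carrier := h ▸ 𝟭 V.carrier

/-- A sequence of operads `P 0, P 1, …`, with `P n` an operad in the category `V n` of `n`-categories,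
where `V 0` is the category of sets and `V (n + 1)` is the category of `(V n, P n)`-categories. -/
structure IterativeTheory : Type (u + 2) where
  V : ℕ → Base.{u}
  P : ∀ n, Operad (V n).carrier
  V_zero : V 0 = Base.set
  V_succ : ∀ n, V (n + 1) = (V n).vpCat (P n)

namespace IterativeTheory

variable (τ : IterativeTheory.{u})

/-- The forgetful functor from the `n`-categories of the theory to `n`-graphs. -/
def U : ∀ n, (τ.V n).carrier ⥤ nGph.{u} n
  | 0 => Base.ofEq τ.V_zero
  | n + 1 => Base.ofEq (τ.V_succ n) ⋙ VPCat.forget (τ.P n) ⋙ VGraph.star (U n)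

/-- The `n`-graph underlying the `n`-category `P n k`. -/
def UP (n k : ℕ) : nGph.{u} n := (τ.U n).obj ((τ.P n).obj k)

/-- The underlying functor of the monad `Q^(n)` for the `n`-categories of the theory:
`Q^(0)` is the identity and `Q^(n + 1) = fc_(V, UP) ∘ (Q^(n))_*`, where `V` is the category of
`n`-graphs and `P = P n`. -/
def Q : ∀ n, nGph.{u} n ⥤ nGph.{u} n
  | 0 => 𝟭 (Type u)
  | n + 1 => VGraph.star (Q n) ⋙ fcOperad (V := nGph n) (τ.UP n)

end IterativeTheory

/-- The underlying functor of the free strict `n`-category monad: `T^(0)` is the identity and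
`T^(n + 1) = fc_V ∘ (T^(n))_*`, where `V` is the category of `n`-graphs. -/
def T : ∀ n, nGph.{u} n ⥤ nGph.{u} n
  | 0 => 𝟭 (Type u)
  | n + 1 => VGraph.star (T n) ⋙ fc (V := nGph n)

/-- The canonical natural transformation from `Q^(n)` to `T^(n)`. -/
def IterativeTheory.toT (τ : IterativeTheory.{u}) : ∀ n, τ.Q n ⟶ T.{u} n
  | 0 => 𝟙 (𝟭 (Type u))
  | n + 1 => VGraph.starMap (toT τ n) ◫ fcProj (V := nGph n) (τ.UP n)

/-! ## Trees -/

/-- Planar trees with `m` stages. An `(m + 1)`-stage tree is a sequence of `m`-stage trees, joined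
by a new base node. -/
inductive StageTree : ℕ → Type
  | point : StageTree 0
  | node {m : ℕ} (k : ℕ) (branch : Fin k → StageTree m) : StageTree (m + 1)

namespace StageTree

/-- `α.Node b k` is the set of nodes of arity `k` at height `b < m` in an `m`-stage tree `α`. (The
nodes at height `m` are the tips of the tree; they have no arity.) -/
inductive Node : {m : ℕ} → StageTree m → ℕ → ℕ → Type
  | base {m k : ℕ} {branch : Fin k → StageTree m} : Node (node k branch) 0 k
  | up {m k : ℕ} {branch : Fin k → StageTree m} (i : Fin k) {b l : ℕ}
      (ν : Node (branch i) b l) : Node (node k branch) (b + 1) l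

/-- The `m`-stage tree obtained from an `(m + 1)`-stage tree by forgetting the top level. -/
def trunc : {m : ℕ} → StageTree (m + 1) → StageTree m
  | 0, _ => point
  | _ + 1, node k branch => node k fun i => trunc (branch i)

/-- The nodes of the truncated tree are nodes of the original one. -/
def Node.ofTrunc : {m : ℕ} → (α : StageTree (m + 1)) → {b k : ℕ} → α.trunc.Node b k → α.Node b k
  | 0, _, b, k, ν => nomatch (show point.Node b k from ν)
  | _ + 1, node l branch, b, k, ν =>
    match b, k, (show (node l fun i => trunc (branch i)).Node b k from ν) with
    | _, _, base => base
    | _, _, up i ν => up i (ofTrunc (branch i) ν)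

end StageTree

open StageTree

/-- The tree of an `m`-cell of `T^(n)(1)`. A `0`-cell gives the `0`-stage tree; an `(m + 1)`-cell of
`T^(n + 1)(1)` is an `m`-cell in a coproduct, over `k`, of `k`-fold products of `T^(n)(1)`, and gives
the sequence of the trees of its `k` components. -/
def treeOf : (n m : ℕ) → Cell.{u} n m ((T n).obj (one n)) → StageTree m
  | _, 0, _ => point
  | 0, _ + 1, c => PEmpty.elim c
  | n + 1, m + 1, ⟨_, _, c⟩ =>
    let d := Cell.ofSigma c
    node d.1.length fun i => treeOf n m (Cell.map (Products.proj d.1.edge i) d.2)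

namespace IterativeTheory

variable (τ : IterativeTheory.{u})

/-- A labelling, for `Q^(n)`, of an `m`-stage tree: every node of arity `k` at height `b < m` gets
an `(m - b - 1)`-cell of `P_(n - b - 1)(k)`, that is, a `j`-cell of `P i k` where `i + b + 1 = n` and
`j + b + 1 = m`. -/
def Labelling (n : ℕ) {m : ℕ} (α : StageTree m) : Type u :=
  ∀ (b k i j : ℕ), i + b + 1 = n → j + b + 1 = m → α.Node b k → Cell i j (τ.UP i k)

/-- Labelled trees. -/
def LabelledTree (n m : ℕ) : Type u := Σ α : StageTree m, τ.Labelling n α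

variable {τ}

/-- Forget the top level of the tree and of the labels, and replace each remaining label by its
source. -/
def LabelledTree.src {n m : ℕ} (L : τ.LabelledTree n (m + 1)) : τ.LabelledTree n m :=
  ⟨L.1.trunc, fun b k i j hi hj ν =>
    Cell.src (L.2 b k i (j + 1) hi (by omega) (ν.ofTrunc L.1))⟩

/-- Forget the top level of the tree and of the labels, and replace each remaining label by its
target. -/
def LabelledTree.tgt {n m : ℕ} (L : τ.LabelledTree n (m + 1)) : τ.LabelledTree n m :=
  ⟨L.1.trunc, fun b k i j hi hj ν =>
    Cell.tgt (L.2 b k i (j + 1) hi (by omega) (ν.ofTrunc L.1))⟩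

/-- The labelled `0`-stage tree. -/
def LabelledTree.point (n : ℕ) : τ.LabelledTree n 0 :=
  ⟨StageTree.point, fun _ _ _ _ _ _ ν => nomatch ν⟩

/-- Join labelled trees by a new base node with a given label. -/
def LabelledTree.join {n m k : ℕ} (p : Cell n m (τ.UP n k)) (L : Fin k → τ.LabelledTree n m) :
    τ.LabelledTree (n + 1) (m + 1) :=
  ⟨StageTree.node k fun i => (L i).1, fun b l i j hi hj ν =>
    match b, l, ν with
    | _, _, Node.base =>
      (show i = n by omega) ▸ (show j = m by omega) ▸ p
    | _, _, Node.up r ν => (L r).2 _ _ i j (by omega) (by omega) ν⟩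

variable (τ)

/-- The labelled tree of an `m`-cell of `Q^(n)(1)`. An `(m + 1)`-cell of `Q^(n + 1)(1)` is an
`m`-cell in a coproduct, over `k`, of the products of `P n k` and `k` copies of `Q^(n)(1)`: its first
component is the label of the base node, and the other components give the branches. -/
def labelledTreeOf : (n m : ℕ) → Cell n m ((τ.Q n).obj (one n)) → τ.LabelledTree n m
  | n, 0, _ => LabelledTree.point n
  | 0, _ + 1, c => PEmpty.elim c
  | n + 1, m + 1, ⟨_, _, c⟩ =>
    let d := Cell.ofSigma c
    LabelledTree.join (Cell.map (d.1.opHead (τ.UP n)) d.2) fun i =>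
      labelledTreeOf n m (Cell.map (d.1.opTail (τ.UP n) i) d.2)

/-- The cell of `T^(n)(1)` over which a cell of `Q^(n)(1)` lies. -/
def shape {n m : ℕ} (x : Cell n m ((τ.Q n).obj (one n))) : Cell n m ((T n).obj (one n)) :=
  Cell.map ((τ.toT n).app (one n)) x

end IterativeTheory

end Iterative

/-! The proof is an induction along the recursions for `T` and `Q`, resting on two facts about
cells: the cells of a coproduct are the disjoint union of the cells of the summands
(`ofSigma_bijective`), and for `m ≤ n` the `m`-cells of a product of `n`-graphs are the families of
`m`-cells of the factors (`toPi_bijective`).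

The suspension of `T n` or `Q n`, applied to the terminal graph, has a single object, so a string in
it is just a length `k`. Hence an `(m + 1)`-cell of `T^(n+1)(1)` is a finite sequence of `m`-cells
of `T^(n)(1)` (`strictComponents_bijective`), which is exactly how stage trees are built. Likewise
an `(m + 1)`-cell of `Q^(n+1)(1)` is a `k`, an `m`-cell of `P n k` and `k` `m`-cells of `Q^(n)(1)`
(`components_bijective`). Labelled trees obey the same recursion (`join_bijective`): the base node
carries an `m`-cell of `P n k`, and a node at height `b` of a branch has height `b + 1` in the whole
tree, so that `n - b - 1` and `m - b - 1` do not change when `n`, `m` and `b` all grow by one. By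
induction the `m`-cells of `T^(n)(1)` and `Q^(n)(1)` are all trees and all labelled trees.

The projection `p` drops the operad factor and acts componentwise on the rest
(`strictComponents_shape`), so the tree under the labels is the tree of the cell lain over. As trees
determine the cells of `T^(n)(1)`, the global bijection restricts to the fibre over each of them.
Sources and targets commute with maps of `n`-graphs, hence with inclusions and projections, and so
are computed component by component. -/

namespace Iterative

/-! ### Cells of coproducts and products of `n`-graphs. -/

namespace Cell

theorem map_comp : ∀ {n m : ℕ} {A B C : nGph.{u} n} (f : A ⟶ B) (g : B ⟶ C) (c : Cell n m A),
    Cell.map (f ≫ g) c = Cell.map g (Cell.map f c)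
  | 0, 0, _, _, _, _, _, _ => rfl
  | 0, _ + 1, _, _, _, _, _, c => PEmpty.elim c
  | _ + 1, 0, _, _, _, _, _, _ => rfl
  | n + 1, m + 1, A, B, C, f, g, ⟨x, y, c⟩ => by
    have h := map_comp (VGraph.Hom.map (V := nGph n) f x y)
      (VGraph.Hom.map (V := nGph n) g (VGraph.Hom.obj (V := nGph n) f x)
        (VGraph.Hom.obj (V := nGph n) f y)) c
    exact congrArg (fun d => (⟨_, _, d⟩ : Cell (n + 1) (m + 1) C)) h

theorem src_map : ∀ {n m : ℕ} {A B : nGph.{u} n} (f : A ⟶ B) (c : Cell n (m + 1) A),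
    (Cell.map f c).src = Cell.map f c.src
  | 0, _, _, _, _, c => PEmpty.elim c
  | _ + 1, 0, _, _, _, _ => rfl
  | n + 1, m + 1, _, B, f, ⟨x, y, c⟩ =>
    congrArg (fun d => (⟨_, _, d⟩ : Cell (n + 1) (m + 1) B))
      (src_map (VGraph.Hom.map (V := nGph n) f x y) c)

theorem tgt_map : ∀ {n m : ℕ} {A B : nGph.{u} n} (f : A ⟶ B) (c : Cell n (m + 1) A),
    (Cell.map f c).tgt = Cell.map f c.tgt
  | 0, _, _, _, _, c => PEmpty.elim c
  | _ + 1, 0, _, _, _, _ => rfl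
  | n + 1, m + 1, _, B, f, ⟨x, y, c⟩ =>
    congrArg (fun d => (⟨_, _, d⟩ : Cell (n + 1) (m + 1) B))
      (tgt_map (VGraph.Hom.map (V := nGph n) f x y) c)

theorem ofSigma_map_inj : ∀ {n m : ℕ} {ι : Type u} {f : ι → nGph.{u} n} (i : ι)
    (c : Cell n m (f i)), ofSigma (Cell.map (Coproducts.inj f i) c) = ⟨i, c⟩
  | 0, 0, _, _, _, _ => rfl
  | 0, _ + 1, _, _, _, c => PEmpty.elim c
  | _ + 1, 0, _, _, _, _ => rfl
  | n + 1, m + 1, ι, f, i, ⟨x, y, c⟩ => by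
    have h := ofSigma_map_inj (f := fun h : ULift.{u} (PLift (i = i)) =>
      VGraph.hom (V := nGph n) (f i) (h.down.down ▸ x) y) ⟨⟨rfl⟩⟩ c
    exact congrArg (fun d : Σ h : ULift.{u} (PLift (i = i)),
        Cell n m (VGraph.hom (V := nGph n) (f i) (h.down.down ▸ x) y) =>
      (⟨i, d.1.down.down ▸ x, y, d.2⟩ : Σ i, Cell (n + 1) (m + 1) (f i))) h

/-- The hom-object between vertices of different summands is an empty coproduct, so a cell in it
forces both vertices into one summand. -/
theorem map_inj_ofSigma : ∀ {n m : ℕ} {ι : Type u} {f : ι → nGph.{u} n}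
    (c : Cell n m (Coproducts.sigma f)),
    Cell.map (Coproducts.inj f (ofSigma c).1) (ofSigma c).2 = c
  | 0, 0, _, _, _ => rfl
  | 0, _ + 1, _, _, c => PEmpty.elim c
  | _ + 1, 0, _, _, _ => rfl
  | n + 1, m + 1, ι, f, ⟨⟨i, x⟩, ⟨j, y⟩, c⟩ => by
    have h := map_inj_ofSigma (f := fun h : ULift.{u} (PLift (i = j)) =>
      VGraph.hom (V := nGph n) (f j) (h.down.down ▸ x) y) c
    -- The index of `c` is itself a proof of `i = j`. Once it is substituted, `c` is an included
    -- cell and the other round trip applies.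
    generalize hd : ofSigma (f := fun h : ULift.{u} (PLift (i = j)) =>
      VGraph.hom (V := nGph n) (f j) (h.down.down ▸ x) y) c = d at h
    obtain ⟨⟨⟨hij⟩⟩, d⟩ := d
    subst hij
    subst h
    exact congrArg (fun e => Cell.map (Coproducts.inj f e.1) e.2)
      (ofSigma_map_inj (f := f) (m := m + 1) i ⟨x, y, d⟩)

theorem ofSigma_bijective {n m : ℕ} {ι : Type u} (f : ι → nGph.{u} n) :
    Function.Bijective (ofSigma (m := m) (f := f)) :=
  Function.bijective_iff_has_inverse.2
    ⟨fun d => Cell.map (Coproducts.inj f d.1) d.2, map_inj_ofSigma,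
      fun d => ofSigma_map_inj d.1 d.2⟩

theorem mapInj_bijective {n m : ℕ} {ι : Type u} (f : ι → nGph.{u} n) :
    Function.Bijective (fun d : Σ i, Cell n m (f i) => Cell.map (Coproducts.inj f d.1) d.2) :=
  Function.bijective_iff_has_inverse.2
    ⟨ofSigma, fun d => ofSigma_map_inj d.1 d.2, map_inj_ofSigma⟩

/-- Every cell of a coproduct is an included one, and inclusions commute with sources, so the source
stays in the same summand. -/
theorem ofSigma_src {n m : ℕ} {ι : Type u} {f : ι → nGph.{u} n}
    (c : Cell n (m + 1) (Coproducts.sigma f)) :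
    ofSigma c.src = ⟨(ofSigma c).1, (ofSigma c).2.src⟩ := by
  conv_lhs => rw [← map_inj_ofSigma c, src_map, ofSigma_map_inj]

theorem ofSigma_tgt {n m : ℕ} {ι : Type u} {f : ι → nGph.{u} n}
    (c : Cell n (m + 1) (Coproducts.sigma f)) :
    ofSigma c.tgt = ⟨(ofSigma c).1, (ofSigma c).2.tgt⟩ := by
  conv_lhs => rw [← map_inj_ofSigma c, tgt_map, ofSigma_map_inj]

/-- The components of a cell of a product. -/
def toPi {n m : ℕ} {ι : Type} (f : ι → nGph.{u} n) (c : Cell n m (Products.pi f)) (i : ι) :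
    Cell n m (f i) :=
  Cell.map (Products.proj f i) c

/-- Objects and hom-objects of a product graph are products, so induction applies to the
hom-objects. The bound on `m` matters for empty `ι`: there is always one empty family, but an
`n`-graph has no cells above dimension `n`. -/
theorem toPi_bijective : ∀ {n m : ℕ} (_ : m ≤ n) {ι : Type} (f : ι → nGph.{u} n),
    Function.Bijective (toPi (m := m) f)
  | 0, 0, _, _, _ => Function.bijective_id
  | 0, _ + 1, h, _, _ => absurd h (Nat.not_succ_le_zero _)
  | _ + 1, 0, _, _, _ => Function.bijective_id
  | n + 1, m + 1, h, ι, f => by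
    have ih := fun (x y : ∀ i, VGraph.obj (V := nGph n) (f i)) => toPi_bijective (n := n) (m := m) (Nat.le_of_succ_le_succ h)
      fun i => VGraph.hom (V := nGph n) (f i) (x i) (y i)
    constructor
    · rintro ⟨x, y, c⟩ ⟨x', y', c'⟩ e
      have hx : x = x' := funext fun i => congrArg Sigma.fst (congrFun e i)
      subst hx
      have e1 : ∀ i, (⟨y i, toPi _ c i⟩ : Σ z, Cell n m (VGraph.hom (V := nGph n) (f i) (x i) z)) =
          ⟨y' i, toPi _ c' i⟩ := fun i => eq_of_heq (Sigma.mk.inj (congrFun e i)).2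
      have hy : y = y' := funext fun i => congrArg Sigma.fst (e1 i)
      subst hy
      have hc : c = c' := (ih x y).1 (funext fun i => eq_of_heq (Sigma.mk.inj (e1 i)).2)
      subst hc
      rfl
    · intro d
      obtain ⟨c, hc⟩ := (ih (fun i => (d i).1) (fun i => (d i).2.1)).2 fun i => (d i).2.2
      refine ⟨⟨fun i => (d i).1, fun i => (d i).2.1, c⟩, funext fun i => ?_⟩
      exact congrArg (fun e => (⟨(d i).1, (d i).2.1, e⟩ : Cell (n + 1) (m + 1) (f i)))
        (congrFun hc i)

end Cell

/-! ### Cells of `T^(n)(1)` as trees. -/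

theorem Chain.ext_of_subsingleton {V : Type (u + 1)} [Category.{u} V] {A : VGraph V}
    [Subsingleton A.obj] {x y : A.obj} {c d : Chain A x y} (h : c.length = d.length) : c = d := by
  obtain ⟨k, a, _, _⟩ := c
  obtain ⟨l, b, _, _⟩ := d
  obtain rfl : k = l := h
  obtain rfl : a = b := Subsingleton.elim _ _
  rfl

/-- An `(m + 1)`-cell of `T^(n + 1)(1)` as a finite sequence of `m`-cells of `T^(n)(1)`. -/
def strictComponents {n m : ℕ} :
    Cell.{u} (n + 1) (m + 1) ((T (n + 1)).obj (one (n + 1))) →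
      Σ k : ℕ, Fin k → Cell.{u} n m ((T n).obj (one n))
  | ⟨_, _, c⟩ =>
    let d := Cell.ofSigma c
    ⟨d.1.length, Cell.toPi d.1.edge d.2⟩

theorem treeOf_succ {n m : ℕ} (c : Cell.{u} (n + 1) (m + 1) ((T (n + 1)).obj (one (n + 1)))) :
    treeOf (n + 1) (m + 1) c =
      .node (strictComponents c).1 fun i => treeOf n m ((strictComponents c).2 i) := rfl

/-- The string of `k` edges in the graph with one object. -/
def constChain {V : Type (u + 1)} [Category.{u} V] (A : V) (k : ℕ) (x y : PUnit.{u + 1}) :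
    Chain (⟨PUnit, fun _ _ => A⟩ : VGraph V) x y :=
  ⟨k, fun _ => PUnit.unit, rfl, rfl⟩

theorem strictComponents_bijective {n m : ℕ} (h : m ≤ n) :
    Function.Bijective (strictComponents.{u} (n := n) (m := m)) := by
  constructor
  · rintro ⟨x, y, c⟩ ⟨x', y', c'⟩ e
    -- The endpoints live in a one-point type, so they agree by definition.
    obtain rfl : x = x' := rfl
    obtain rfl : y = y' := rfl
    refine congrArg (fun d => (⟨x, y, d⟩ : Cell (n + 1) (m + 1) ((T (n + 1)).obj (one (n + 1)))))
      ((Cell.ofSigma_bijective _).1 ?_)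
    change (⟨(Cell.ofSigma c).1.length, Cell.toPi (Cell.ofSigma c).1.edge (Cell.ofSigma c).2⟩ :
      Σ k : ℕ, Fin k → Cell.{u} n m ((T n).obj (one n))) =
      ⟨(Cell.ofSigma c').1.length, Cell.toPi (Cell.ofSigma c').1.edge (Cell.ofSigma c').2⟩ at e
    generalize Cell.ofSigma c = d at e ⊢
    -- The type of the second component depends on the string, so both pairs are abstracted before
    -- the strings are identified by their lengths.
    generalize Cell.ofSigma c' = d' at e ⊢
    obtain ⟨s, d⟩ := d
    obtain ⟨s', d'⟩ := d'
    have : Subsingleton (VGraph.obj ((VGraph.star (T n)).obj (one (n + 1)))) :=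
      inferInstanceAs (Subsingleton PUnit)
    obtain rfl : s = s' := Chain.ext_of_subsingleton (congrArg Sigma.fst e)
    exact congrArg (Sigma.mk s) ((Cell.toPi_bijective h _).1 (eq_of_heq (Sigma.mk.inj e).2))
  · rintro ⟨k, t⟩
    let s := constChain ((T.{u} n).obj (one n)) k PUnit.unit PUnit.unit
    obtain ⟨d, hd⟩ := (Cell.toPi_bijective h s.edge).2 t
    obtain ⟨c, hc⟩ := (Cell.ofSigma_bijective _).2
      (⟨s, d⟩ : Σ s : Chain (⟨PUnit, fun _ _ => (T.{u} n).obj (one n)⟩ : VGraph (nGph n))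
        PUnit.unit PUnit.unit, Cell n m s.prod)
    refine ⟨⟨PUnit.unit, PUnit.unit, c⟩, ?_⟩
    subst hd
    exact congrArg (fun d : Σ s : Chain (⟨PUnit, fun _ _ => (T.{u} n).obj (one n)⟩ :
        VGraph (nGph n)) PUnit.unit PUnit.unit, Cell n m s.prod =>
      (⟨d.1.length, Cell.toPi d.1.edge d.2⟩ :
        Σ k : ℕ, Fin k → Cell.{u} n m ((T n).obj (one n)))) hc

/-- Taking sources keeps the summand and commutes with projections. The dimension `m + 2` leaves a
source of positive dimension, which still has components. -/
theorem strictComponents_src {n m : ℕ}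
    (c : Cell.{u} (n + 1) (m + 2) ((T (n + 1)).obj (one (n + 1)))) :
    strictComponents (m := m) c.src =
      ⟨(strictComponents c).1, fun i => ((strictComponents c).2 i).src⟩ := by
  obtain ⟨x, y, c⟩ := c
  refine (congrArg (fun d : Σ s : Chain (⟨PUnit, fun _ _ => (T.{u} n).obj (one n)⟩ :
      VGraph (nGph n)) x y, Cell n m s.prod =>
    (⟨d.1.length, Cell.toPi d.1.edge d.2⟩ :
      Σ k : ℕ, Fin k → Cell.{u} n m ((T n).obj (one n)))) (Cell.ofSigma_src c)).trans ?_
  exact congrArg (Sigma.mk _) (funext fun i => (Cell.src_map _ _).symm)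

theorem strictComponents_tgt {n m : ℕ}
    (c : Cell.{u} (n + 1) (m + 2) ((T (n + 1)).obj (one (n + 1)))) :
    strictComponents (m := m) c.tgt =
      ⟨(strictComponents c).1, fun i => ((strictComponents c).2 i).tgt⟩ := by
  obtain ⟨x, y, c⟩ := c
  refine (congrArg (fun d : Σ s : Chain (⟨PUnit, fun _ _ => (T.{u} n).obj (one n)⟩ :
      VGraph (nGph n)) x y, Cell n m s.prod =>
    (⟨d.1.length, Cell.toPi d.1.edge d.2⟩ :
      Σ k : ℕ, Fin k → Cell.{u} n m ((T n).obj (one n)))) (Cell.ofSigma_tgt c)).trans ?_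
  exact congrArg (Sigma.mk _) (funext fun i => (Cell.tgt_map _ _).symm)

/-- `T n` does not change `0`-cells, so there is one cell for the one `0`-stage tree; above
dimension `0`, cells and trees are both finite sequences of smaller ones. -/
theorem treeOf_bijective : ∀ {n m : ℕ}, m ≤ n → Function.Bijective (treeOf.{u} n m)
  | 0, 0, _ => ⟨fun _ _ _ => rfl, fun
    | .point => ⟨PUnit.unit, rfl⟩⟩
  | _ + 1, 0, _ => ⟨fun _ _ _ => rfl, fun
    | .point => ⟨PUnit.unit, rfl⟩⟩
  | n + 1, m + 1, h => by
    have hm := Nat.le_of_succ_le_succ h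
    have ih := treeOf_bijective hm
    constructor
    · intro c c' e
      refine (strictComponents_bijective hm).1 ?_
      rw [treeOf_succ, treeOf_succ] at e
      generalize strictComponents c = d at e ⊢
      generalize strictComponents c' = d' at e ⊢
      obtain ⟨k, d⟩ := d
      obtain ⟨k', d'⟩ := d'
      obtain ⟨hk, e⟩ := StageTree.node.inj e
      obtain rfl : k = k' := hk
      exact congrArg (Sigma.mk k) (funext fun i => ih.1 (congrFun (eq_of_heq e) i))
    · rintro (_ | ⟨k, b⟩)
      choose t ht using fun i => ih.2 (b i)
      obtain ⟨c, hc⟩ := (strictComponents_bijective hm).2 ⟨k, t⟩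
      refine ⟨c, ?_⟩
      rw [treeOf_succ, hc]
      exact congrArg (StageTree.node k) (funext ht)

theorem StageTree.eq_point : ∀ α : StageTree 0, α = .point
  | .point => rfl

/-- The recursion ends at `0`-stage trees, of which there is only one. No bound on `m` is needed,
because above dimension `n` there are no cells. -/
theorem treeOf_src : ∀ {n m : ℕ} (c : Cell.{u} n (m + 1) ((T n).obj (one n))),
    treeOf n m c.src = (treeOf n (m + 1) c).trunc
  | 0, _, c => PEmpty.elim c
  | _ + 1, 0, _ => (StageTree.eq_point _).trans (StageTree.eq_point _).symm
  | n + 1, m + 1, c => by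
    rw [treeOf_succ, treeOf_succ, strictComponents_src]
    exact congrArg (StageTree.node _) (funext fun i => treeOf_src _)

theorem treeOf_tgt : ∀ {n m : ℕ} (c : Cell.{u} n (m + 1) ((T n).obj (one n))),
    treeOf n m c.tgt = (treeOf n (m + 1) c).trunc
  | 0, _, c => PEmpty.elim c
  | _ + 1, 0, _ => (StageTree.eq_point _).trans (StageTree.eq_point _).symm
  | n + 1, m + 1, c => by
    rw [treeOf_succ, treeOf_succ, strictComponents_tgt]
    exact congrArg (StageTree.node _) (funext fun i => treeOf_tgt _)

/-! ### Products with an operad factor, and forgetting that factor. -/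

/-- The components of a cell of the product `P k × A (a 0, a 1) × ⋯ × A (a (k - 1), a k)`. -/
def Chain.opCell {n m : ℕ} (P : ℕ → nGph.{u} n) {A : VGraph (nGph.{u} n)} {x y : A.obj}
    (s : Chain A x y) (d : Cell n m (s.opProd P)) :
    Cell n m (P s.length) × ∀ i, Cell n m (s.edge i) :=
  (Cell.map (s.opHead P) d, fun i => Cell.map (s.opTail P i) d)

/-- The product is indexed by `Option (Fin k)`, with `none` for the operad factor, so a family of
cells splits into its value there and the rest. -/
theorem Chain.opCell_bijective {n m : ℕ} (h : m ≤ n) (P : ℕ → nGph.{u} n)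
    {A : VGraph (nGph.{u} n)} {x y : A.obj} (s : Chain A x y) :
    Function.Bijective (s.opCell (m := m) P) := by
  have hb := Cell.toPi_bijective h (consFam (P s.length) s.edge)
  constructor
  · intro d d' e
    refine hb.1 (funext fun o => ?_)
    cases o with
    | none => exact congrArg Prod.fst e
    | some i => exact congrFun (congrArg Prod.snd e) i
  · rintro ⟨p, q⟩
    obtain ⟨d, hd⟩ := hb.2 fun
      | none => p
      | some i => q i
    exact ⟨d, Prod.ext (congrFun hd none) (funext fun i => congrFun hd (some i))⟩

/-- With `f` the suspension of `p`, the composite on the left is the next stage of `p` on a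
hom-object. The right side exhibits the summand into which the cell is sent, namely that of the
image string. -/
theorem Cell.map_fcProjHom_fcHom {n m : ℕ} (P : ℕ → nGph.{u} n) {A B : VGraph (nGph.{u} n)}
    (f : A ⟶ B) {x y : A.obj} (s : Chain A x y) (d : Cell n m (s.opProd P)) :
    Cell.map (fcProjHom P A x y ≫ fcHom f x y) (Cell.map (fcOperadInj P s) d) =
      Cell.map (fcInj (s.map f)) (Cell.map (s.prodMap f) (Cell.map (s.forgetHead P) d)) := by
  rw [← Cell.map_comp, ← Cell.map_comp, ← Cell.map_comp, ← Category.assoc,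
    fcOperadInj_fcProjHom, Category.assoc, fcInj_hom]

theorem Chain.toPi_prodMap_forgetHead {n m : ℕ} (P : ℕ → nGph.{u} n) {A B : VGraph (nGph.{u} n)}
    (f : A ⟶ B) {x y : A.obj} (s : Chain A x y) (d : Cell n m (s.opProd P)) (i : Fin s.length) :
    Cell.toPi (s.map f).edge (Cell.map (s.prodMap f) (Cell.map (s.forgetHead P) d)) i =
      Cell.map (s.edgeMap f i) ((s.opCell P d).2 i) := by
  refine (Cell.map_comp _ _ _).symm.trans ?_
  refine (congrArg (fun g => Cell.map g _) (Products.lift_proj _ i)).trans ?_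
  refine (Cell.map_comp _ _ _).trans ?_
  refine congrArg (Cell.map _) ((Cell.map_comp _ _ _).symm.trans ?_)
  exact congrArg (fun g => Cell.map g d) (Products.lift_proj _ i)

/-! ### Cells of `Q^(n)(1)` and their components. -/

namespace IterativeTheory

variable {τ : IterativeTheory.{u}}

/-- An `(m + 1)`-cell of `Q^(n + 1)(1)` as an `m`-cell of `P n k` together with `k` `m`-cells of
`Q^(n)(1)`. -/
def components {n m : ℕ} : Cell (n + 1) (m + 1) ((τ.Q (n + 1)).obj (one (n + 1))) →
    Σ k : ℕ, Cell n m (τ.UP n k) × (Fin k → Cell n m ((τ.Q n).obj (one n)))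
  | ⟨_, _, c⟩ =>
    let d := Cell.ofSigma c
    ⟨d.1.length, d.1.opCell (τ.UP n) d.2⟩

theorem labelledTreeOf_succ {n m : ℕ}
    (c : Cell (n + 1) (m + 1) ((τ.Q (n + 1)).obj (one (n + 1)))) :
    τ.labelledTreeOf (n + 1) (m + 1) c =
      .join (components c).2.1 fun i => τ.labelledTreeOf n m ((components c).2.2 i) := rfl

theorem components_bijective {n m : ℕ} (h : m ≤ n) :
    Function.Bijective (components (τ := τ) (n := n) (m := m)) := by
  constructor
  · rintro ⟨x, y, c⟩ ⟨x', y', c'⟩ e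
    obtain rfl : x = x' := rfl
    obtain rfl : y = y' := rfl
    refine congrArg (fun d =>
        (⟨x, y, d⟩ : Cell (n + 1) (m + 1) ((τ.Q (n + 1)).obj (one (n + 1)))))
      ((Cell.ofSigma_bijective _).1 ?_)
    change (⟨(Cell.ofSigma c).1.length, (Cell.ofSigma c).1.opCell (τ.UP n) (Cell.ofSigma c).2⟩ :
      Σ k : ℕ, Cell n m (τ.UP n k) × (Fin k → Cell n m ((τ.Q n).obj (one n)))) =
      ⟨(Cell.ofSigma c').1.length,
        (Cell.ofSigma c').1.opCell (τ.UP n) (Cell.ofSigma c').2⟩ at e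
    generalize Cell.ofSigma c = d at e ⊢
    generalize Cell.ofSigma c' = d' at e ⊢
    obtain ⟨s, d⟩ := d
    obtain ⟨s', d'⟩ := d'
    have : Subsingleton (VGraph.obj ((VGraph.star (τ.Q n)).obj (one (n + 1)))) :=
      inferInstanceAs (Subsingleton PUnit)
    obtain rfl : s = s' := Chain.ext_of_subsingleton (congrArg Sigma.fst e)
    exact congrArg (Sigma.mk s) ((s.opCell_bijective h _).1 (eq_of_heq (Sigma.mk.inj e).2))
  · rintro ⟨k, t⟩
    let s := constChain ((τ.Q n).obj (one n)) k PUnit.unit PUnit.unit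
    obtain ⟨d, hd⟩ := (s.opCell_bijective h (τ.UP n)).2 t
    obtain ⟨c, hc⟩ := (Cell.ofSigma_bijective _).2
      (⟨s, d⟩ : Σ s : Chain (⟨PUnit, fun _ _ => (τ.Q n).obj (one n)⟩ : VGraph (nGph n))
        PUnit.unit PUnit.unit, Cell n m (s.opProd (τ.UP n)))
    refine ⟨⟨PUnit.unit, PUnit.unit, c⟩, ?_⟩
    subst hd
    exact congrArg (fun d : Σ s : Chain (⟨PUnit, fun _ _ => (τ.Q n).obj (one n)⟩ :
        VGraph (nGph n)) PUnit.unit PUnit.unit, Cell n m (s.opProd (τ.UP n)) =>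
      (⟨d.1.length, d.1.opCell (τ.UP n) d.2⟩ :
        Σ k : ℕ, Cell n m (τ.UP n k) × (Fin k → Cell n m ((τ.Q n).obj (one n))))) hc

theorem components_src {n m : ℕ}
    (c : Cell (n + 1) (m + 2) ((τ.Q (n + 1)).obj (one (n + 1)))) :
    components (m := m) c.src =
      ⟨(components c).1, (components c).2.1.src, fun i => ((components c).2.2 i).src⟩ := by
  obtain ⟨x, y, c⟩ := c
  refine (congrArg (fun d : Σ s : Chain (⟨PUnit, fun _ _ => (τ.Q n).obj (one n)⟩ :
      VGraph (nGph n)) x y, Cell n m (s.opProd (τ.UP n)) =>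
    (⟨d.1.length, d.1.opCell (τ.UP n) d.2⟩ :
      Σ k : ℕ, Cell n m (τ.UP n k) × (Fin k → Cell n m ((τ.Q n).obj (one n)))))
    (Cell.ofSigma_src c)).trans ?_
  exact congrArg (Sigma.mk _)
    (Prod.ext (Cell.src_map _ _).symm (funext fun i => (Cell.src_map _ _).symm))

theorem components_tgt {n m : ℕ}
    (c : Cell (n + 1) (m + 2) ((τ.Q (n + 1)).obj (one (n + 1)))) :
    components (m := m) c.tgt =
      ⟨(components c).1, (components c).2.1.tgt, fun i => ((components c).2.2 i).tgt⟩ := by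
  obtain ⟨x, y, c⟩ := c
  refine (congrArg (fun d : Σ s : Chain (⟨PUnit, fun _ _ => (τ.Q n).obj (one n)⟩ :
      VGraph (nGph n)) x y, Cell n m (s.opProd (τ.UP n)) =>
    (⟨d.1.length, d.1.opCell (τ.UP n) d.2⟩ :
      Σ k : ℕ, Cell n m (τ.UP n k) × (Fin k → Cell n m ((τ.Q n).obj (one n)))))
    (Cell.ofSigma_tgt c)).trans ?_
  exact congrArg (Sigma.mk _)
    (Prod.ext (Cell.tgt_map _ _).symm (funext fun i => (Cell.tgt_map _ _).symm))

/-- This is the recursion for `p`: the length of the string is kept, the operad factor is lost, and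
the previous stage of `p` acts on each component. -/
theorem strictComponents_shape {n m : ℕ}
    (c : Cell (n + 1) (m + 1) ((τ.Q (n + 1)).obj (one (n + 1)))) :
    strictComponents (τ.shape c) =
      ⟨(components c).1, fun i => τ.shape ((components c).2.2 i)⟩ := by
  obtain ⟨x, y, c⟩ := c
  let f := (VGraph.starMap (τ.toT n)).app (one (n + 1))
  -- On an included cell `p` can be computed in the summand of `s`; both sides are then compared
  -- with the value read off from `s` and `d`.
  obtain ⟨⟨s, d⟩, rfl⟩ := (Cell.mapInj_bijective
    (fun s : Chain ((VGraph.star (τ.Q n)).obj (one (n + 1))) x y => s.opProd (τ.UP n))).2 c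
  refine Eq.trans (b := (⟨s.length, fun i => τ.shape ((s.opCell (τ.UP n) d).2 i)⟩ :
    Σ k : ℕ, Fin k → Cell.{u} n m ((T n).obj (one n)))) ?_ ?_
  · refine (congrArg (fun e => strictComponents.{u} (n := n) (m := m) ⟨x, y, e⟩)
      (Cell.map_fcProjHom_fcHom (τ.UP n) f s d)).trans ?_
    refine (congrArg (fun d : Σ s : Chain ((VGraph.star (T n)).obj (one (n + 1))) x y,
        Cell n m s.prod => (⟨d.1.length, Cell.toPi d.1.edge d.2⟩ :
          Σ k : ℕ, Fin k → Cell.{u} n m ((T n).obj (one n))))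
      (Cell.ofSigma_map_inj (s.map f) _)).trans ?_
    exact congrArg (Sigma.mk s.length) (funext fun i => Chain.toPi_prodMap_forgetHead _ f s d i)
  · exact (congrArg (fun d : Σ s : Chain ((VGraph.star (τ.Q n)).obj (one (n + 1))) x y,
        Cell n m (s.opProd (τ.UP n)) =>
      (⟨d.1.length, fun i => τ.shape ((d.1.opCell (τ.UP n) d.2).2 i)⟩ :
        Σ k : ℕ, Fin k → Cell.{u} n m ((T n).obj (one n))))
      (Cell.ofSigma_map_inj s d)).symm

/-! ### Joining and splitting labelled trees. -/

namespace LabelledTree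

theorem eq_point {n : ℕ} : ∀ L : τ.LabelledTree n 0, L = point n
  | ⟨.point, _⟩ => congrArg (Sigma.mk StageTree.point)
      (funext fun _ => funext fun _ => funext fun _ => funext fun _ => funext fun _ =>
        funext fun _ => funext fun ν => nomatch ν)

theorem labelling_ext {n m : ℕ} {α : StageTree m} {L L' : τ.Labelling n α}
    (h : ∀ b k i j hi hj ν, L b k i j hi hj ν = L' b k i j hi hj ν) : L = L' := by
  funext b k i j hi hj ν
  exact h b k i j hi hj ν

/-- The label of the base node and the branches. -/
def split {n m : ℕ} : τ.LabelledTree (n + 1) (m + 1) →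
    Σ k : ℕ, Cell n m (τ.UP n k) × (Fin k → τ.LabelledTree n m)
  | ⟨.node k branch, L⟩ => ⟨k, L 0 k n m rfl rfl .base, fun r =>
      ⟨branch r, fun b l i j hi hj ν =>
        L (b + 1) l i j (by omega) (by omega) (.up r ν)⟩⟩

theorem split_join {n m k : ℕ} (p : Cell n m (τ.UP n k)) (L : Fin k → τ.LabelledTree n m) :
    split (join p L) = ⟨k, p, L⟩ := rfl

theorem join_split {n m : ℕ} : ∀ L : τ.LabelledTree (n + 1) (m + 1),
    join (split L).2.1 (split L).2.2 = L
  | ⟨.node k branch, L⟩ => by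
    refine congrArg (Sigma.mk (StageTree.node k branch)) (labelling_ext ?_)
    intro b l i j hi hj ν
    cases ν with
    | base =>
      -- The base node has height `0`, which forces `i = n` and `j = m` and so makes the casts in
      -- `join` trivial.
      obtain rfl : i = n := by omega
      obtain rfl : j = m := by omega
      rfl
    | up r ν => rfl

theorem join_bijective (τ : IterativeTheory.{u}) (n m : ℕ) : Function.Bijective
    fun d : Σ k : ℕ, Cell n m (τ.UP n k) × (Fin k → τ.LabelledTree n m) => join d.2.1 d.2.2 :=
  Function.bijective_iff_has_inverse.2 ⟨split, fun d => split_join d.2.1 d.2.2, join_split⟩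

/-- The joined tree has at least two stages, so truncation keeps its base node and only cuts the
branches. -/
theorem src_join {n m k : ℕ} (p : Cell n (m + 1) (τ.UP n k))
    (L : Fin k → τ.LabelledTree n (m + 1)) :
    (join p L).src = join p.src fun r => (L r).src := by
  refine congrArg (Sigma.mk (StageTree.node k fun r => (L r).1.trunc)) (labelling_ext ?_)
  intro b l i j hi hj ν
  cases ν with
  | base =>
    obtain rfl : i = n := by omega
    obtain rfl : j = m := by omega
    rfl
  | up r ν => rfl

theorem tgt_join {n m k : ℕ} (p : Cell n (m + 1) (τ.UP n k))
    (L : Fin k → τ.LabelledTree n (m + 1)) :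
    (join p L).tgt = join p.tgt fun r => (L r).tgt := by
  refine congrArg (Sigma.mk (StageTree.node k fun r => (L r).1.trunc)) (labelling_ext ?_)
  intro b l i j hi hj ν
  cases ν with
  | base =>
    obtain rfl : i = n := by omega
    obtain rfl : j = m := by omega
    rfl
  | up r ν => rfl

end LabelledTree

/-! ### Cells of `Q^(n)(1)` as labelled trees. -/

theorem labelledTreeOf_bijective : ∀ {n m : ℕ}, m ≤ n → Function.Bijective (τ.labelledTreeOf n m)
  | 0, 0, _ => ⟨fun _ _ _ => rfl, fun L => ⟨PUnit.unit, (LabelledTree.eq_point L).symm⟩⟩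
  | _ + 1, 0, _ => ⟨fun _ _ _ => rfl, fun L => ⟨PUnit.unit, (LabelledTree.eq_point L).symm⟩⟩
  | n + 1, m + 1, h => by
    have hm := Nat.le_of_succ_le_succ h
    have ih := labelledTreeOf_bijective hm
    -- The map factors as `components`, then the identity on the base label and the inductive
    -- bijection on each branch, then `join`.
    have hc : ∀ k : ℕ, Function.Bijective (Prod.map (id : Cell n m (τ.UP n k) → _)
        (τ.labelledTreeOf n m ∘ · : (Fin k → _) → _)) := fun k =>
      Function.bijective_id.prodMap ⟨ih.1.comp_left, ih.2.comp_left⟩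
    exact (LabelledTree.join_bijective τ n m).comp
      ((Function.Bijective.comp
        ⟨Function.injective_id.sigma_map fun k => (hc k).1,
          Function.surjective_id.sigma_map fun k => (hc k).2⟩) (components_bijective hm))

theorem labelledTreeOf_fst : ∀ {n m : ℕ} (x : Cell n m ((τ.Q n).obj (one n))),
    (τ.labelledTreeOf n m x).1 = treeOf n m (τ.shape x)
  | 0, 0, _ => rfl
  | 0, _ + 1, x => PEmpty.elim x
  | _ + 1, 0, _ => rfl
  | n + 1, m + 1, x => by
    rw [treeOf_succ, strictComponents_shape]
    exact congrArg (StageTree.node _) (funext fun i => labelledTreeOf_fst _)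

theorem labelledTreeOf_src : ∀ {n m : ℕ} (x : Cell n (m + 1) ((τ.Q n).obj (one n))),
    τ.labelledTreeOf n m x.src = (τ.labelledTreeOf n (m + 1) x).src
  | 0, _, x => PEmpty.elim x
  | _ + 1, 0, _ => (LabelledTree.eq_point _).trans (LabelledTree.eq_point _).symm
  | n + 1, m + 1, x => by
    rw [labelledTreeOf_succ, labelledTreeOf_succ, components_src, LabelledTree.src_join]
    exact congrArg (LabelledTree.join _) (funext fun i => labelledTreeOf_src _)

theorem labelledTreeOf_tgt : ∀ {n m : ℕ} (x : Cell n (m + 1) ((τ.Q n).obj (one n))),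
    τ.labelledTreeOf n m x.tgt = (τ.labelledTreeOf n (m + 1) x).tgt
  | 0, _, x => PEmpty.elim x
  | _ + 1, 0, _ => (LabelledTree.eq_point _).trans (LabelledTree.eq_point _).symm
  | n + 1, m + 1, x => by
    rw [labelledTreeOf_succ, labelledTreeOf_succ, components_tgt, LabelledTree.tgt_join]
    exact congrArg (LabelledTree.join _) (funext fun i => labelledTreeOf_tgt _)

/-- The labelled tree alone determines the cell. That the cell lies over `α` follows, since its
shape has the same tree as `α` and `treeOf` is injective. -/
theorem existsUnique_labelledTreeOf {n m : ℕ} (h : m ≤ n) (α : Cell.{u} n m ((T n).obj (one n)))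
    (L : τ.Labelling n (treeOf n m α)) :
    ∃! x : Cell n m ((τ.Q n).obj (one n)),
      τ.shape x = α ∧ τ.labelledTreeOf n m x = ⟨treeOf n m α, L⟩ := by
  obtain ⟨x, hx⟩ := (labelledTreeOf_bijective h).2 ⟨treeOf n m α, L⟩
  refine ⟨x, ⟨(treeOf_bijective h).1 ?_, hx⟩, fun y hy =>
    (labelledTreeOf_bijective h).1 (hy.2.trans hx.symm)⟩
  rw [← labelledTreeOf_fst, hx]

end IterativeTheory

end Iterative

theorem mainTheorem3 (τ : Iterative.IterativeTheory.{u}) (n : ℕ) (hn : 0 < n) :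
    -- the `m`-cells of `T^(n)(1)` are the `m`-stage trees
    (∀ m ≤ n, Function.Bijective (Iterative.treeOf.{u} n m)) ∧
    -- both the source and the target of a tree forget its top level
    (∀ (m : ℕ) (α : Iterative.Cell n (m + 1) ((Iterative.T.{u} n).obj (Iterative.one n))),
      Iterative.treeOf n m α.src = (Iterative.treeOf n (m + 1) α).trunc ∧
      Iterative.treeOf n m α.tgt = (Iterative.treeOf n (m + 1) α).trunc) ∧
    -- the labels of an element of `Q^(n)(1)` sit on the tree over which the element lies
    (∀ (m : ℕ) (x : Iterative.Cell n m ((τ.Q n).obj (Iterative.one n))),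
      (τ.labelledTreeOf n m x).1 = Iterative.treeOf n m (τ.shape x)) ∧
    -- an element over `α` amounts to a labelling of the nodes of `α`
    (∀ m ≤ n, ∀ (α : Iterative.Cell n m ((Iterative.T.{u} n).obj (Iterative.one n)))
      (L : τ.Labelling n (Iterative.treeOf n m α)),
      ∃! x : Iterative.Cell n m ((τ.Q n).obj (Iterative.one n)),
        τ.shape x = α ∧ τ.labelledTreeOf n m x = ⟨Iterative.treeOf n m α, L⟩) ∧
    -- the source and the target of an element
    (∀ (m : ℕ) (x : Iterative.Cell n (m + 1) ((τ.Q n).obj (Iterative.one n))),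
      τ.labelledTreeOf n m x.src = (τ.labelledTreeOf n (m + 1) x).src ∧
      τ.labelledTreeOf n m x.tgt = (τ.labelledTreeOf n (m + 1) x).tgt) := by

  exact ⟨fun _ => Iterative.treeOf_bijective,
    fun _ α => ⟨Iterative.treeOf_src α, Iterative.treeOf_tgt α⟩,
    fun _ => Iterative.IterativeTheory.labelledTreeOf_fst,
    fun _ => Iterative.IterativeTheory.existsUnique_labelledTreeOf,
    fun _ x => ⟨Iterative.IterativeTheory.labelledTreeOf_src x,
      Iterative.IterativeTheory.labelledTreeOf_tgt x⟩⟩
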